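/- **Signature.** Two pointer sorts, trains ($\mathsf t$) and track segments ($\mathsf s$), each with a constant $\mathrm{null}$ ($tnil$, $snil$), and two scalar sorts (reals, integers). Static functions: $nexts, prevs:\mathsf s\to\mathsf s$, $tid:\mathsf t\to\mathbb Z$, $sid:\mathsf s\to\mathbb Z$, $length, lmax:\mathsf s\to\mathbb R$; static parameters $gmax,decmax,d,\Delta t:\mathbb R$ and $bd:\mathbb R\to\mathbb R$. Flexible symbols (each with a primed copy for the value after a transition): $train, incoming:\mathsf s\to\mathsf t$, $next,prev:\mathsf t\to\mathsf t$, $segm:\mathsf t\to\mathsf s$, $req,alloc:\mathsf s\to\mathbb Z$, $spd,pos:\mathsf t\to\mathbb R$, and an integer program counter $pc$. There are also free pointer and scalar constants, and constants for the inputs of the events $enter$ and $leave$. Universally quantified constraints are implicitly restricted to non-null elements: a constraint is only required where all proper subterms of pointer sort of its terms are non-null. **Scalar theory.** Let $K$ be any class of models of the combination of the first-order theories of the reals and of the integers, with arbitrary interpretations of $gmax,decmax,d,\Delta t,bd$ (for example the class of all such models). **Background theory** $\mathcal T$: structures with scalar part in $K$ that satisfy $d\ge bd(gmax)+gmax\cdot\Delta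 t$; $tid(t)>0$; $tid(t_1)\ne tid(t_2)$ for $t_1\neq t_2$; $prevs(nexts(s))=s$; $nexts(prevs(s))=s$; $sid(s)>0$; $sid(nexts(s))>sid(s)$; $sid(s_1)\neq sid(s_2)$ for $s_1\ne s_2$; $length(s)>d+gmax\cdot\Delta t$; $0<lmax(s)\le gmax$; $lmax(s)\ge lmax(prevs(s))-decmax\cdot\Delta t$; and $tid(incoming(s_1))\ne tid(train(s_2))$, the last one for both the unprimed and the primed symbols. **Init schema:** $train(segm(t))=t$; $next(prev(t))=t$; $prev(next(t))=t$; $0\le pos(t)\le length(segm(t))$; $0\le spd(t)\le lmax(segm(t))$; $alloc(segm(t))=tid(t)$; $alloc(nexts(segm(t)))=tid(t)\lor length(segm(t))-bd(spd(t))>pos(t)$; $segm(train(s))=s$. **Safe:** $t_1\ne t_2\to sid(segm(t_1))\neq sid(segm(t_2))$. **Update.** The disjunction of the transitions of the following control flow on the locations $Main$ (the initial location), $State1$, $State2$, $State3$, encoded as $pc=0,1,2,3$: the events $updSpd$, $req$, $alloc$, $updPos$ lead from each location to the next one cyclically, and $enter$ and $leave$ are possible at each location and do not change it. Each event has an effect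 schema, and the functions $train,req,alloc,segm,next,spd,pos,prev$ not listed as changed by the schema keep their values (on non-null arguments). With $\beta(t)=\max\{0,spd(t)-decmax\cdot\Delta t\}$, the schema $updSpd$ changes only $spd$, and requires * if $pos(t)<length(segm(t))-d$ and $spd(t)-decmax\cdot\Delta t>0$ then $\beta(t)\le spd'(t)\le lmax(segm(t))$; * if $pos(t)\ge length(segm(t))-d$ and $alloc(nexts(segm(t)))=tid(t)$ then $\beta(t)\le spd'(t)\le\min\{lmax(segm(t)),lmax(nexts(segm(t)))\}$; * if $pos(t)\ge length(segm(t))-d$ and $alloc(nexts(segm(t)))\ne tid(t)$ then $spd'(t)=\beta(t)$. The schemata of the other five events are arbitrary finite sets of update rules. An update rule is a universally quantified (over pointer variables) disjunction of pointer equalities, negated pointer equalities and a scalar formula without free scalar variables, over unprimed and primed symbols, containing the disjunct $u=\mathrm{null}$ for every non-ground proper subterm $u$ of pointer sort of its terms and for every non-ground side $u$ of a negated pointer equality and every non-ground subterm of such a side. (All ground clauses are update rules.) **Extended pointer clauses** are formulas $\forall\bar p\,(\mathcal E\lor\varphi)$, $\bar p$ pointer variables, where $\mathcal E$ is a disjunction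 of pointer equalities which contains $u=\mathrm{null}$ for every proper subterm $u$ (of pointer sort) of a term occurring in $\mathcal E\lor\varphi$, and $\varphi$ (the scalar part) is an arbitrary scalar formula, possibly with quantified scalar variables; free scalar and pointer constants may occur. **Decidable fragment.** A set $F$ of scalar formulas with free scalar constants, closed under negation and conjunction, such that satisfiability in $K$ of formulas in $F$ is decidable. The scalar part $\varphi$ of a clause *belongs to* $F$ if every formula obtained from $\varphi$ by replacing its atomic terms ($f(u)$ with $u$ of pointer sort, $pc$, $pc'$, scalar constants) by free scalar constants is in $F$. **Corollary.** Let $K$, $F$ and the effect schemata be as above, and suppose that the scalar parts of the clauses of $\mathcal T$, the initial condition, $\mathsf{Safe}$ and $\mathsf{Update}$ belong to $F$. Then each of the following problems is decidable, for the inputs $\mathsf{Inv}$ that are finite sets of extended pointer clauses over the unprimed symbols and free constants (without event inputs) whose scalar parts belong to $F$: 1. $\mathsf{Inv}\models_{\mathcal T}\mathsf{Safe}$; 2. $\mathsf{Init}\models_{\mathcal T}\mathsf{Inv}$, both for $\mathsf{Init}$ the Init schema together with $pc=Main$, and for $\mathsf{Init}$ the Init schema alone; 3. $\mathsf{Inv}\land\mathsf{Update}\models_{\mathcal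 T}\mathsf{Inv}'$, where $\mathsf{Inv}'$ is obtained from $\mathsf{Inv}$ by priming all flexible symbols. That is, for each problem there is a computable function on codes of finite sets of clauses that gives the correct answer on the codes of all such $\mathsf{Inv}$. -/

import Mathlib

namespace RBC

/-! ### Sorts and symbols -/

/-- Pointer sorts: trains and track segments. -/
inductive PSort
  | train
  | seg
  deriving DecidableEq

/-- Scalar sorts: real numbers and integers. -/
inductive SSort
  | real
  | int
  deriving DecidableEq

/-- Function symbols from a pointer sort to a pointer sort. The flag of a symbol that may change
over time is `false` for the value before a transition and `true` for the primed symbol. -/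
inductive PSym : PSort → PSort → Type
  | nexts : PSym .seg .seg
  | prevs : PSym .seg .seg
  | next (primed : Bool) : PSym .train .train
  | prev (primed : Bool) : PSym .train .train
  | segm (primed : Bool) : PSym .train .seg
  | train (primed : Bool) : PSym .seg .train
  | incoming (primed : Bool) : PSym .seg .train

/-- Function symbols from a pointer sort to a scalar sort. -/
inductive SSym : PSort → SSort → Type
  | tid : SSym .train .int
  | sid : SSym .seg .int
  | length : SSym .seg .real
  | lmax : SSym .seg .real
  | req (primed : Bool) : SSym .seg .int
  | alloc (primed : Bool) : SSym .seg .int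
  | spd (primed : Bool) : SSym .train .real
  | pos (primed : Bool) : SSym .train .real

/-- Pointer constants: free constants, and the inputs of the methods `enter` and `leave`. -/
inductive PConst : PSort → Type
  | free (p : PSort) (i : ℕ) : PConst p
  | enterS1 : PConst .seg
  | enterT0 : PConst .train
  | enterT1 : PConst .train
  | enterT2 : PConst .train
  | leaveS : PConst .seg
  | leaveT : PConst .train

/-- The constant system parameters. -/
inductive Param
  | gmax
  | decmax
  | d
  | dt

/-- Pointer terms. Variables are the universally quantified ones of a clause. -/
inductive PTerm : PSort → Type
  | var (p : PSort) (i : ℕ) : PTerm p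
  | const {p : PSort} (c : PConst p) : PTerm p
  | null (p : PSort) : PTerm p
  | app {p q : PSort} (f : PSym p q) (t : PTerm p) : PTerm q

/-! ### Scalar terms and formulas, over a family `A` of atomic scalar terms -/

inductive BinOp
  | add
  | sub
  | mul
  | max
  | min

inductive Rel
  | eq
  | le
  | lt

inductive STerm (A : SSort → Type) : SSort → Type
  | var (σ : SSort) (i : ℕ) : STerm A σ
  | atom {σ : SSort} (a : A σ) : STerm A σ
  | zero (σ : SSort) : STerm A σ
  | one (σ : SSort) : STerm A σ
  | bin {σ : SSort} (o : BinOp) (s t : STerm A σ) : STerm A σ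
  | param (x : Param) : STerm A .real
  | bd (t : STerm A .real) : STerm A .real

inductive SForm (A : SSort → Type) : Type
  | falsum : SForm A
  | rel {σ : SSort} (r : Rel) (s t : STerm A σ) : SForm A
  | neg (φ : SForm A) : SForm A
  | and (φ ψ : SForm A) : SForm A
  | all (σ : SSort) (i : ℕ) (φ : SForm A) : SForm A

namespace SForm

def or {A : SSort → Type} (φ ψ : SForm A) : SForm A := neg (and (neg φ) (neg ψ))

def imp {A : SSort → Type} (φ ψ : SForm A) : SForm A := neg (and φ (neg ψ))

def ex {A : SSort → Type} (σ : SSort) (i : ℕ) (φ : SForm A) : SForm A := neg (all σ i (neg φ))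

end SForm

section Expressions

variable {A B : SSort → Type}

/-- Replacement of the atomic terms. -/
def STerm.map (θ : ∀ σ, A σ → B σ) : {σ : SSort} → STerm A σ → STerm B σ
  | _, .var σ i => .var σ i
  | σ, .atom a => .atom (θ σ a)
  | _, .zero σ => .zero σ
  | _, .one σ => .one σ
  | _, .bin o s t => .bin o (s.map θ) (t.map θ)
  | _, .param x => .param x
  | _, .bd t => .bd (t.map θ)

def SForm.map (θ : ∀ σ, A σ → B σ) : SForm A → SForm B
  | .falsum => .falsum
  | .rel r s t => .rel r (s.map θ) (t.map θ)
  | .neg φ => .neg (φ.map θ)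
  | .and φ ψ => .and (φ.map θ) (ψ.map θ)
  | .all σ i φ => .all σ i (φ.map θ)

/-- The atomic terms that occur. -/
def STerm.atoms : {σ : SSort} → STerm A σ → List (Sigma A)
  | σ, .atom a => [⟨σ, a⟩]
  | _, .bin _ s t => s.atoms ++ t.atoms
  | _, .bd t => t.atoms
  | _, _ => []

def SForm.atoms : SForm A → List (Sigma A)
  | .falsum => []
  | .rel _ s t => s.atoms ++ t.atoms
  | .neg φ => φ.atoms
  | .and φ ψ => φ.atoms ++ ψ.atoms
  | .all _ _ φ => φ.atoms

/-- Scalar variables occurring in a term. -/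
def STerm.vars : {σ : SSort} → STerm A σ → Set (SSort × ℕ)
  | _, .var σ i => {(σ, i)}
  | _, .bin _ s t => s.vars ∪ t.vars
  | _, .bd t => t.vars
  | _, _ => ∅

/-- Free scalar variables. -/
def SForm.free : SForm A → Set (SSort × ℕ)
  | .falsum => ∅
  | .rel _ s t => s.vars ∪ t.vars
  | .neg φ => φ.free
  | .and φ ψ => φ.free ∪ ψ.free
  | .all σ i φ => φ.free \ {(σ, i)}

def SForm.Closed (φ : SForm A) : Prop := φ.free = ∅

/-- No system parameter (neither a constant one nor `bd`) occurs. -/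
def STerm.ParamFree : {σ : SSort} → STerm A σ → Prop
  | _, .bin _ s t => s.ParamFree ∧ t.ParamFree
  | _, .param _ => False
  | _, .bd _ => False
  | _, _ => True

def SForm.ParamFree : SForm A → Prop
  | .falsum => True
  | .rel _ s t => s.ParamFree ∧ t.ParamFree
  | .neg φ => φ.ParamFree
  | .and φ ψ => φ.ParamFree ∧ ψ.ParamFree
  | .all _ _ φ => φ.ParamFree

end Expressions

/-! ### Scalar structures -/

structure ScalarStr where
  carrier : SSort → Type
  zero : ∀ σ, carrier σ
  one : ∀ σ, carrier σ
  bin : BinOp → ∀ σ, carrier σ → carrier σ → carrier σ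
  le : ∀ σ, carrier σ → carrier σ → Prop
  lt : ∀ σ, carrier σ → carrier σ → Prop
  param : Param → carrier .real
  bd : carrier .real → carrier .real

section Semantics

variable {A : SSort → Type} (S : ScalarStr) (α : ∀ σ, A σ → S.carrier σ)

def STerm.eval (v : ∀ x : SSort × ℕ, S.carrier x.1) : {σ : SSort} → STerm A σ → S.carrier σ
  | _, .var σ i => v (σ, i)
  | σ, .atom a => α σ a
  | _, .zero σ => S.zero σ
  | _, .one σ => S.one σ
  | σ, .bin o s t => S.bin o σ (s.eval v) (t.eval v)
  | _, .param x => S.param x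
  | _, .bd t => S.bd (t.eval v)

def ScalarStr.rel : Rel → ∀ σ, S.carrier σ → S.carrier σ → Prop
  | .eq => fun _ a b => a = b
  | .le => S.le
  | .lt => S.lt

def SForm.Holds (v : ∀ x : SSort × ℕ, S.carrier x.1) : SForm A → Prop
  | .falsum => False
  | .rel (σ := σ) r s t => S.rel r σ (s.eval S α v) (t.eval S α v)
  | .neg φ => ¬ φ.Holds v
  | .and φ ψ => φ.Holds v ∧ ψ.Holds v
  | .all σ i φ => ∀ a : S.carrier σ, φ.Holds (Function.update v (σ, i) a)

end Semantics

/-- The standard carriers. -/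
def StdCarrier : SSort → Type
  | .real => ℝ
  | .int => ℤ

noncomputable instance (σ : SSort) : CommRing (StdCarrier σ) :=
  match σ with
  | .real => inferInstanceAs (CommRing ℝ)
  | .int => inferInstanceAs (CommRing ℤ)

noncomputable instance (σ : SSort) : LinearOrder (StdCarrier σ) :=
  match σ with
  | .real => inferInstanceAs (LinearOrder ℝ)
  | .int => inferInstanceAs (LinearOrder ℤ)

/-- The real numbers and the integers, with some values of the system parameters. -/
noncomputable def stdScalar (prm : Param → ℝ) (bd : ℝ → ℝ) : ScalarStr where
  carrier := StdCarrier
  zero _ := 0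
  one _ := 1
  bin o _ a b :=
    match o with
    | .add => a + b
    | .sub => a - b
    | .mul => a * b
    | .max => max a b
    | .min => min a b
  le _ a b := a ≤ b
  lt _ a b := a < b
  param := prm
  bd := bd

/-- `S` is a model of the combination of the first-order theories of the real numbers and of the
integers: all sentences that are true of `ℝ` and `ℤ` and do not speak about the system parameters
hold in `S`. The system parameters are interpreted arbitrarily. -/
def ScalarStr.IsRealInt (S : ScalarStr) : Prop :=
  ∀ φ : SForm (fun _ => Empty), φ.Closed → φ.ParamFree →
    (∀ prm bd v, φ.Holds (stdScalar prm bd) (fun _ e => e.elim) v) →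
      ∀ v, φ.Holds S (fun _ e => e.elim) v

/-- Pure scalar formulas: the atomic terms are free scalar constants, numbered in each sort. -/
abbrev ScalarFormula : Type := SForm (fun _ => ℕ)

/-- Satisfiability of a scalar formula in the class `K` of models of the scalar theory. -/
def ScalarFormula.Satisfiable (K : Set ScalarStr) (φ : ScalarFormula) : Prop :=
  ∃ S ∈ K, ∃ c : ∀ σ, ℕ → S.carrier σ, ∃ v, SForm.Holds S c v φ

/-! ### Clauses over pointers and scalars -/

/-- Atomic scalar terms over the pointer signature: free scalar constants, the program counter,
and applications of scalar-valued functions to pointer terms. -/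
inductive Atom : SSort → Type
  | const (σ : SSort) (i : ℕ) : Atom σ
  | pc (primed : Bool) : Atom .int
  | field {p : PSort} {σ : SSort} (f : SSym p σ) (t : PTerm p) : Atom σ

/-- An equality between pointer terms of the same sort. -/
structure PEq where
  srt : PSort
  lhs : PTerm srt
  rhs : PTerm srt

/-- The formula `∀ p̄, ⋁ pos ∨ ⋁ ¬ neg ∨ body`, where `p̄` are all the pointer variables. -/
structure Clause where
  pos : List PEq
  neg : List PEq
  body : SForm Atom

/-- All subterms, the term itself included. -/
def PTerm.subs : {p : PSort} → PTerm p → List (Sigma PTerm)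
  | p, .app f t => ⟨p, .app f t⟩ :: t.subs
  | p, t => [⟨p, t⟩]

/-- The proper subterms. -/
def PTerm.proper : {p : PSort} → PTerm p → List (Sigma PTerm)
  | _, .app _ t => t.subs
  | _, _ => []

/-- The pointer terms below a scalar-valued function. -/
def Atom.subs : {σ : SSort} → Atom σ → List (Sigma PTerm)
  | _, .field _ t => t.subs
  | _, _ => []

/-- The pointer terms of a clause that have to be compared with `null`: the proper subterms of the
terms `f(t)` in the clause, and the sides of the negated pointer equalities with their subterms. -/
def Clause.guardTerms (c : Clause) : List (Sigma PTerm) :=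
  c.pos.flatMap (fun e => e.lhs.proper ++ e.rhs.proper) ++
    c.neg.flatMap (fun e => e.lhs.subs ++ e.rhs.subs) ++
      c.body.atoms.flatMap (fun a => a.2.subs)

/-- The clause has a disjunct `u = null`. -/
def Clause.Guards (c : Clause) (u : Sigma PTerm) : Prop :=
  (⟨u.1, u.2, .null u.1⟩ : PEq) ∈ c.pos ∨ (⟨u.1, .null u.1, u.2⟩ : PEq) ∈ c.pos

/-- Extended pointer clauses `∀ p̄, E ∨ φ`: `E` is a disjunction of pointer equalities containing
`t' = null` for every proper subterm `t'` of a term `f(t)` of the clause, and `φ` is an arbitrary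
scalar formula without free scalar variables. -/
def Clause.IsExtended (c : Clause) : Prop :=
  c.neg = [] ∧ c.body.Closed ∧ ∀ u ∈ c.guardTerms, c.Guards u

/-- No variables occur. -/
def PTerm.IsGround : {p : PSort} → PTerm p → Prop
  | _, .var _ _ => False
  | _, .const _ => True
  | _, .null _ => True
  | _, .app _ t => t.IsGround

/-- Update rules: clauses about non-null elements. In contrast to extended pointer clauses,
equalities between non-null pointers may also occur negatively (as conditions of the rule), and
there is no restriction on ground terms. In particular all ground clauses are update rules. -/
def Clause.IsRule (c : Clause) : Prop :=
  c.body.Closed ∧ ∀ u ∈ c.guardTerms, u.2.IsGround ∨ c.Guards u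

/-- The clause with the implicit restriction to non-null elements made explicit. -/
def Clause.guarded (pos neg : List PEq) (body : SForm Atom) : Clause where
  pos := (Clause.guardTerms ⟨pos, neg, body⟩).map (fun u => ⟨u.1, u.2, .null u.1⟩) ++ pos
  neg := neg
  body := body

/-! ### Priming and state formulas -/

def PSym.prime : {p q : PSort} → PSym p q → PSym p q
  | _, _, .nexts => .nexts
  | _, _, .prevs => .prevs
  | _, _, .next _ => .next true
  | _, _, .prev _ => .prev true
  | _, _, .segm _ => .segm true
  | _, _, .train _ => .train true
  | _, _, .incoming _ => .incoming true

def SSym.prime : {p : PSort} → {σ : SSort} → SSym p σ → SSym p σ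
  | _, _, .tid => .tid
  | _, _, .sid => .sid
  | _, _, .length => .length
  | _, _, .lmax => .lmax
  | _, _, .req _ => .req true
  | _, _, .alloc _ => .alloc true
  | _, _, .spd _ => .spd true
  | _, _, .pos _ => .pos true

def PTerm.prime : {p : PSort} → PTerm p → PTerm p
  | _, .app f t => .app f.prime t.prime
  | _, t => t

def Atom.prime : (σ : SSort) → Atom σ → Atom σ
  | _, .const σ i => .const σ i
  | _, .pc _ => .pc true
  | _, .field f t => .field f.prime t.prime

def PEq.prime (e : PEq) : PEq := ⟨e.srt, e.lhs.prime, e.rhs.prime⟩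

/-- Replace each symbol that may change over time by its primed version. -/
def Clause.prime (c : Clause) : Clause :=
  ⟨c.pos.map PEq.prime, c.neg.map PEq.prime, c.body.map Atom.prime⟩

def PSym.IsState : {p q : PSort} → PSym p q → Prop
  | _, _, .nexts => True
  | _, _, .prevs => True
  | _, _, .next b => b = false
  | _, _, .prev b => b = false
  | _, _, .segm b => b = false
  | _, _, .train b => b = false
  | _, _, .incoming b => b = false

def SSym.IsState : {p : PSort} → {σ : SSort} → SSym p σ → Prop
  | _, _, .tid => True
  | _, _, .sid => True
  | _, _, .length => True
  | _, _, .lmax => True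
  | _, _, .req b => b = false
  | _, _, .alloc b => b = false
  | _, _, .spd b => b = false
  | _, _, .pos b => b = false

def PConst.IsFree : {p : PSort} → PConst p → Prop
  | _, .free _ _ => True
  | _, _ => False

def PTerm.IsState : {p : PSort} → PTerm p → Prop
  | _, .var _ _ => True
  | _, .const c => c.IsFree
  | _, .null _ => True
  | _, .app f t => f.IsState ∧ t.IsState

def Atom.IsState : {σ : SSort} → Atom σ → Prop
  | _, .const _ _ => True
  | _, .pc b => b = false
  | _, .field f t => f.IsState ∧ t.IsState

/-- A clause about a single state: no primed symbols, and no inputs of events. -/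
def Clause.IsState (c : Clause) : Prop :=
  (∀ e ∈ c.pos ++ c.neg, e.lhs.IsState ∧ e.rhs.IsState) ∧ ∀ a ∈ c.body.atoms, a.2.IsState

/-! ### Structures and entailment -/

/-- Structures over the whole signature (with the primed symbols and all constants) whose scalar
part is `S`. -/
structure Str (S : ScalarStr) where
  carrier : PSort → Type
  null : ∀ p, carrier p
  pconst : ∀ p, PConst p → carrier p
  pfun : ∀ p q, PSym p q → carrier p → carrier q
  sconst : ∀ σ, ℕ → S.carrier σ
  pc : Bool → S.carrier .int
  sfun : ∀ p σ, SSym p σ → carrier p → S.carrier σ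

section Structures

variable {S : ScalarStr} (M : Str S)

def PTerm.eval (w : ∀ p, ℕ → M.carrier p) : {p : PSort} → PTerm p → M.carrier p
  | _, .var p i => w p i
  | p, .const c => M.pconst p c
  | _, .null p => M.null p
  | q, .app (p := p) f t => M.pfun p q f (t.eval w)

def Atom.eval (w : ∀ p, ℕ → M.carrier p) : (σ : SSort) → Atom σ → S.carrier σ
  | _, .const σ i => M.sconst σ i
  | _, .pc b => M.pc b
  | σ, .field (p := p) f t => M.sfun p σ f (t.eval M w)

def PEq.Holds (w : ∀ p, ℕ → M.carrier p) (e : PEq) : Prop := e.lhs.eval M w = e.rhs.eval M w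

/-- Truth of a clause in a structure. -/
def Clause.Holds (c : Clause) : Prop :=
  ∀ (w : ∀ p, ℕ → M.carrier p) (v : ∀ x : SSort × ℕ, S.carrier x.1),
    (∃ e ∈ c.pos, e.Holds M w) ∨ (∃ e ∈ c.neg, ¬ e.Holds M w) ∨
      c.body.Holds S (Atom.eval M w) v

def HoldsAll (Φ : List Clause) : Prop := ∀ c ∈ Φ, c.Holds M

end Structures

/-- `P ⊨ Q` modulo the background axioms `T` over the scalar theory with class of models `K`:
every model of the background theory that satisfies `P` satisfies `Q`. -/
def Entails (K : Set ScalarStr) (T : List Clause) (P Q : ∀ S : ScalarStr, Str S → Prop) : Prop :=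
  ∀ S ∈ K, ∀ M : Str S, HoldsAll M T → P S M → Q S M

/-- A transition constraint system. The flexible symbols are those of the signature with a primed
version; a set of clauses stands for its conjunction, and the transition relation is the
disjunction of the members of `update`. -/
structure TCS where
  init : List Clause
  update : List (List Clause)

/-- The conjunction of some clauses, as a property of structures. -/
def asProp (Φ : List Clause) : ∀ S : ScalarStr, Str S → Prop := fun _ M => HoldsAll M Φ

/-- The transition relation of a transition constraint system. -/
def TCS.Update (T : TCS) : ∀ S : ScalarStr, Str S → Prop := fun _ M => ∃ Φ ∈ T.update, HoldsAll M Φ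

/-! ### The case study -/

section CaseStudy

/-- The variables `t, t1` (`= t`) and `t2` for trains, and `s, s1` (`= s`) and `s2` for segments. -/
def vt : PTerm .train := .var .train 0
def vt2 : PTerm .train := .var .train 1
def vs : PTerm .seg := .var .seg 0
def vs2 : PTerm .seg := .var .seg 1

def nexts (s : PTerm .seg) : PTerm .seg := .app .nexts s
def prevs (s : PTerm .seg) : PTerm .seg := .app .prevs s
def next (t : PTerm .train) (b : Bool := false) : PTerm .train := .app (.next b) t
def prev (t : PTerm .train) (b : Bool := false) : PTerm .train := .app (.prev b) t
def segm (t : PTerm .train) (b : Bool := false) : PTerm .seg := .app (.segm b) t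
def train (s : PTerm .seg) (b : Bool := false) : PTerm .train := .app (.train b) s
def incoming (s : PTerm .seg) (b : Bool := false) : PTerm .train := .app (.incoming b) s

def fld {p : PSort} {σ : SSort} (f : SSym p σ) (t : PTerm p) : STerm Atom σ := .atom (.field f t)

def tid (t : PTerm .train) : STerm Atom .int := fld .tid t
def sid (s : PTerm .seg) : STerm Atom .int := fld .sid s
def length (s : PTerm .seg) : STerm Atom .real := fld .length s
def lmax (s : PTerm .seg) : STerm Atom .real := fld .lmax s
def req (s : PTerm .seg) (b : Bool := false) : STerm Atom .int := fld (.req b) s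
def alloc (s : PTerm .seg) (b : Bool := false) : STerm Atom .int := fld (.alloc b) s
def spd (t : PTerm .train) (b : Bool := false) : STerm Atom .real := fld (.spd b) t
def pos (t : PTerm .train) (b : Bool := false) : STerm Atom .real := fld (.pos b) t

def gmax : STerm Atom .real := .param .gmax
def decmax : STerm Atom .real := .param .decmax
def dist : STerm Atom .real := .param .d
def dt : STerm Atom .real := .param .dt

def add {σ : SSort} (a b : STerm Atom σ) : STerm Atom σ := .bin .add a b
def sub {σ : SSort} (a b : STerm Atom σ) : STerm Atom σ := .bin .sub a b
def mul {σ : SSort} (a b : STerm Atom σ) : STerm Atom σ := .bin .mul a b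

def eq {σ : SSort} (a b : STerm Atom σ) : SForm Atom := .rel .eq a b
def ne {σ : SSort} (a b : STerm Atom σ) : SForm Atom := .neg (.rel .eq a b)
def le {σ : SSort} (a b : STerm Atom σ) : SForm Atom := .rel .le a b
def lt {σ : SSort} (a b : STerm Atom σ) : SForm Atom := .rel .lt a b

/-- A pointer equality (for non-null elements). -/
def ptrEq {p : PSort} (t u : PTerm p) : Clause := .guarded [⟨p, t, u⟩] [] .falsum

/-- A scalar condition (for non-null elements). -/
def scal (φ : SForm Atom) : Clause := .guarded [] [] φ

/-- A scalar condition on distinct (non-null) elements `t` and `u`. -/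
def scalNe {p : PSort} (t u : PTerm p) (φ : SForm Atom) : Clause := .guarded [⟨p, t, u⟩] [] φ

/-- The constraints on system parameters, identifiers, and the track. -/
def stateAxioms : List Clause :=
  [ scal (le (add (.bd gmax) (mul gmax dt)) dist),
    scal (lt (.zero _) (tid vt)),
    scalNe vt vt2 (ne (tid vt) (tid vt2)),
    ptrEq (prevs (nexts vs)) vs,
    ptrEq (nexts (prevs vs)) vs,
    scal (lt (.zero _) (sid vs)),
    scal (lt (sid vs) (sid (nexts vs))),
    scalNe vs vs2 (ne (sid vs) (sid vs2)),
    scal (lt (add dist (mul gmax dt)) (length vs)),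
    scal (.and (lt (.zero _) (lmax vs)) (le (lmax vs) gmax)),
    scal (le (sub (lmax (prevs vs)) (mul decmax dt)) (lmax vs)),
    scal (ne (tid (incoming vs)) (tid (train vs2))) ]

/-- The axioms of the background theory hold before and after every transition (this only matters
for the constraint on `incoming`, the others do not contain flexible symbols). -/
def background : List Clause := stateAxioms ++ stateAxioms.map Clause.prime

/-- The `Init` schema. -/
def initSchema : List Clause :=
  [ ptrEq (train (segm vt)) vt,
    ptrEq (next (prev vt)) vt,
    ptrEq (prev (next vt)) vt,
    scal (.and (le (.zero _) (pos vt)) (le (pos vt) (length (segm vt)))),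
    scal (.and (le (.zero _) (spd vt)) (le (spd vt) (lmax (segm vt)))),
    scal (eq (alloc (segm vt)) (tid vt)),
    scal (.or (eq (alloc (nexts (segm vt))) (tid vt))
      (lt (pos vt) (sub (length (segm vt)) (.bd (spd vt))))),
    ptrEq (segm (train vs)) vs ]

/-- The safety property: there are no two trains on the same segment. -/
def safe : List Clause := [scalNe vt vt2 (ne (sid (segm vt)) (sid (segm vt2)))]

/-- The functions declared in the data classes. -/
inductive Field
  | train
  | req
  | alloc
  | segm
  | next
  | spd
  | pos
  | prev
  deriving DecidableEq

/-- The function is not changed by a transition. -/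
def frame : Field → Clause
  | .train => ptrEq (train vs true) (train vs)
  | .req => scal (eq (req vs true) (req vs))
  | .alloc => scal (eq (alloc vs true) (alloc vs))
  | .segm => ptrEq (segm vt true) (segm vt)
  | .next => ptrEq (next vt true) (next vt)
  | .spd => scal (eq (spd vt true) (spd vt))
  | .pos => scal (eq (pos vt true) (pos vt))
  | .prev => ptrEq (prev vt true) (prev vt)

/-- An effect schema: the list of the functions that it changes, and its constraints. -/
structure Schema where
  changes : List Field
  constraints : List Clause

/-- All constraints are update rules. -/
def Schema.WellFormed (E : Schema) : Prop := ∀ c ∈ E.constraints, c.IsRule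

/-- The formula of an effect schema; functions that are not listed as changed keep their value. -/
def Schema.clauses (E : Schema) : List Clause :=
  E.constraints ++
    ([Field.train, .req, .alloc, .segm, .next, .spd, .pos, .prev].filter
      (fun f => f ∉ E.changes)).map frame

/-- The speed after maximal braking, `max {0, spd(t) - decmax * Δt}`. -/
def braked : STerm Atom .real := .bin .max (.zero _) (sub (spd vt) (mul decmax dt))

/-- The speed update. -/
def updSpd : Schema where
  changes := [.spd]
  constraints :=
    [ scal (.imp
        (.and (lt (pos vt) (sub (length (segm vt)) dist))
          (lt (.zero _) (sub (spd vt) (mul decmax dt))))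
        (.and (le braked (spd vt true)) (le (spd vt true) (lmax (segm vt))))),
      scal (.imp
        (.and (le (sub (length (segm vt)) dist) (pos vt))
          (eq (alloc (nexts (segm vt))) (tid vt)))
        (.and (le braked (spd vt true))
          (le (spd vt true) (.bin .min (lmax (segm vt)) (lmax (nexts (segm vt))))))),
      scal (.imp
        (.and (le (sub (length (segm vt)) dist) (pos vt))
          (ne (alloc (nexts (segm vt))) (tid vt)))
        (eq (spd vt true) braked)) ]

/-- The effect schemata of the events other than `updSpd`. -/
structure Effects where
  req : Schema
  alloc : Schema
  updPos : Schema
  enter : Schema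
  leave : Schema

def Effects.WellFormed (E : Effects) : Prop :=
  E.req.WellFormed ∧ E.alloc.WellFormed ∧ E.updPos.WellFormed ∧ E.enter.WellFormed ∧
    E.leave.WellFormed

/-- Integer numerals, `0 + 1 + ⋯ + 1`. -/
def numeral : ℕ → STerm Atom .int
  | 0 => .zero _
  | n + 1 => add (numeral n) (.one _)

/-- The program counter, before (`b = false`) or after (`b = true`) a transition, is at location
`n`: `Main`, `State1`, `State2`, `State3` are the locations `0, 1, 2, 3`. -/
def pcAt (b : Bool) (n : ℕ) : Clause := scal (eq (.atom (.pc b)) (numeral n))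

/-- The transition from location `m` to location `n` with the given effect. -/
def transition (m n : ℕ) (E : Schema) : List Clause := pcAt false m :: pcAt true n :: E.clauses

/-- The transition constraint system of the controller: the four phases in cyclic order, and
trains entering or leaving at every location. -/
def system (E : Effects) : TCS where
  init := pcAt false 0 :: initSchema
  update :=
    [ transition 0 1 updSpd, transition 1 2 E.req, transition 2 3 E.alloc,
      transition 3 0 E.updPos ] ++
    [0, 1, 2, 3].map (fun n => transition n n E.enter) ++
    [0, 1, 2, 3].map (fun n => transition n n E.leave)

end CaseStudy

/-! ### Fragments of the scalar theory -/

/-- The scalar formula of a clause lies in `F`, whatever free scalar constants are put in place of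
its terms `f(t)` with `t` of pointer sort, of the program counter and of its scalar constants. -/
def InFragment (F : Set ScalarFormula) (φ : SForm Atom) : Prop :=
  ∀ θ : ∀ σ, Atom σ → ℕ, φ.map θ ∈ F

/-- The scalar formulas of the background axioms, the initial condition, the safety property and
the transitions. -/
def systemScalarParts (E : Effects) : List (SForm Atom) :=
  (background ++ (system E).init ++ safe ++ (system E).update.flatten).map Clause.body

/-- Candidate invariants: finite sets of extended pointer clauses about a state with scalar part
in `F`. -/
def Admissible (F : Set ScalarFormula) (Inv : List Clause) : Prop :=
  ∀ c ∈ Inv, c.IsExtended ∧ c.IsState ∧ InFragment F c.body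

/-! ### Codes of formulas -/

def PSort.code : PSort → ℕ
  | .train => 0
  | .seg => 1

def SSort.code : SSort → ℕ
  | .real => 0
  | .int => 1

def PSym.code : {p q : PSort} → PSym p q → ℕ
  | _, _, .nexts => Nat.pair 0 0
  | _, _, .prevs => Nat.pair 1 0
  | _, _, .next b => Nat.pair 2 b.toNat
  | _, _, .prev b => Nat.pair 3 b.toNat
  | _, _, .segm b => Nat.pair 4 b.toNat
  | _, _, .train b => Nat.pair 5 b.toNat
  | _, _, .incoming b => Nat.pair 6 b.toNat

def SSym.code : {p : PSort} → {σ : SSort} → SSym p σ → ℕ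
  | _, _, .tid => Nat.pair 0 0
  | _, _, .sid => Nat.pair 1 0
  | _, _, .length => Nat.pair 2 0
  | _, _, .lmax => Nat.pair 3 0
  | _, _, .req b => Nat.pair 4 b.toNat
  | _, _, .alloc b => Nat.pair 5 b.toNat
  | _, _, .spd b => Nat.pair 6 b.toNat
  | _, _, .pos b => Nat.pair 7 b.toNat

def PConst.code : {p : PSort} → PConst p → ℕ
  | _, .free p i => Nat.pair 0 (Nat.pair p.code i)
  | _, .enterS1 => Nat.pair 1 0
  | _, .enterT0 => Nat.pair 2 0
  | _, .enterT1 => Nat.pair 3 0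
  | _, .enterT2 => Nat.pair 4 0
  | _, .leaveS => Nat.pair 5 0
  | _, .leaveT => Nat.pair 6 0

def Param.code : Param → ℕ
  | .gmax => 0
  | .decmax => 1
  | .d => 2
  | .dt => 3

def BinOp.code : BinOp → ℕ
  | .add => 0
  | .sub => 1
  | .mul => 2
  | .max => 3
  | .min => 4

def Rel.code : Rel → ℕ
  | .eq => 0
  | .le => 1
  | .lt => 2

def PTerm.code : {p : PSort} → PTerm p → ℕ
  | _, .var p i => Nat.pair 0 (Nat.pair p.code i)
  | _, .const c => Nat.pair 1 c.code
  | _, .null p => Nat.pair 2 p.code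
  | _, .app f t => Nat.pair 3 (Nat.pair f.code t.code)

def Atom.code : (σ : SSort) → Atom σ → ℕ
  | _, .const σ i => Nat.pair 0 (Nat.pair σ.code i)
  | _, .pc b => Nat.pair 1 b.toNat
  | _, .field f t => Nat.pair 2 (Nat.pair f.code t.code)

section Codes

variable {A : SSort → Type} (κ : ∀ σ, A σ → ℕ)

/-- The code of a scalar term of a given sort, for codes `κ` of the atomic terms. -/
def STerm.code : {σ : SSort} → STerm A σ → ℕ
  | _, .var _ i => Nat.pair 0 i
  | σ, .atom a => Nat.pair 1 (κ σ a)
  | _, .zero _ => Nat.pair 2 0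
  | _, .one _ => Nat.pair 3 0
  | _, .bin o s t => Nat.pair 4 (Nat.pair o.code (Nat.pair s.code t.code))
  | _, .param x => Nat.pair 5 x.code
  | _, .bd t => Nat.pair 6 t.code

def SForm.code : SForm A → ℕ
  | .falsum => Nat.pair 0 0
  | .rel (σ := σ) r s t =>
      Nat.pair 1 (Nat.pair σ.code (Nat.pair r.code (Nat.pair (s.code κ) (t.code κ))))
  | .neg φ => Nat.pair 2 φ.code
  | .and φ ψ => Nat.pair 3 (Nat.pair φ.code ψ.code)
  | .all σ i φ => Nat.pair 4 (Nat.pair σ.code (Nat.pair i φ.code))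

end Codes

def ScalarFormula.code (φ : ScalarFormula) : ℕ := SForm.code (fun _ i => i) φ

def PEq.code (e : PEq) : ℕ := Nat.pair e.srt.code (Nat.pair e.lhs.code e.rhs.code)

def Clause.code (c : Clause) : ℕ :=
  Nat.pair (Encodable.encode (c.pos.map PEq.code))
    (Nat.pair (Encodable.encode (c.neg.map PEq.code)) (c.body.code Atom.code))

/-- The code of a finite set of clauses, given as a list. -/
def codeClauses (Φ : List Clause) : ℕ := Encodable.encode (Φ.map Clause.code)

/-- A decision procedure for the problem `P` on the instances in `D`, given by their codes. -/
def Decides {α : Type} (code : α → ℕ) (D P : α → Prop) : Prop :=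
  ∃ f : ℕ → Bool, Computable f ∧ ∀ x, D x → (f (code x) = true ↔ P x)

/-- `F` is a decidable fragment of the scalar theory with class of models `K`: a set of formulas,
closed under negation and conjunction, in which satisfiability is decidable. -/
structure IsDecidableFragment (K : Set ScalarStr) (F : Set ScalarFormula) : Prop where
  neg : ∀ φ ∈ F, SForm.neg φ ∈ F
  and : ∀ φ ∈ F, ∀ ψ ∈ F, SForm.and φ ψ ∈ F
  decidable : Decides ScalarFormula.code (· ∈ F) (ScalarFormula.Satisfiable K)

end RBC

/-! The scalar part of a model is never touched; only the pointer part has to be made finite. Let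
`A` be the assumptions (background, candidate invariant, transition, all of them update rules) and
`G` the goal, let `M` be a model of `A`, and let a clause of `G` fail in `M` at a valuation `w`. Let
`n` bound the codes of all clauses involved. Keep `null` and the values at `w`, read with unprimed
and with primed symbols, of all pointer terms with code at most `n`. Restrict every pointer function
to this finite set, sending a value that leaves it to `null`.

The failing clause still fails, because all its terms keep their values (`Restriction.not_holds`).
The rules of `A` still hold (`Restriction.holds`): if a guarded term of a rule leaves the set, it
becomes `null` and its disjunct `u = null` is true. Unguarded terms are harmless: the ground ones
among those that need a guard have values in the set, and an outermost side of a positive equality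
may leave it, since two equal sides leave together and both become `null`. So a counterexample
exists if and only if there is one with at most `sizeBound n` non-null elements of each sort
(`exists_restriction`).

There are finitely many such pointer structures up to isomorphism, and they are numbered by tables
of digits. In a fixed one, each instance of a clause has pointer equalities with known truth values,
and each atomic scalar term can be replaced by a free scalar constant named by its symbol and the
number of its argument. What remains is a scalar formula (`inst`, `holds_inst`). The disjunction
over all tables of "every instance of `A` holds and some instance of `G` fails" is built by negation
and conjunction only, so it belongs to `F`, and it is satisfiable in `K` exactly when the entailment
fails (`satisfiable_counterexample`).

For computability the same construction is carried out on codes by primitive recursive functions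
(`code_counterexample`, `primrec_counterexampleCode`) and composed with the decision procedure of
`F`. The problems of the theorem are instances of `IsDecidableFragment.decides_entailment`; the
disjunction of transitions becomes a finite conjunction of entailments. -/

namespace RBC

/-! ### Primitive recursive functions -/

/-- The first component of a coded pair. -/
def _root_.Nat.codeFst (n : ℕ) : ℕ := n.unpair.1

/-- The second component of a coded pair. -/
def _root_.Nat.codeSnd (n : ℕ) : ℕ := n.unpair.2

@[simp]
theorem codeFst_pair (a b : ℕ) : (Nat.pair a b).codeFst = a := by simp [Nat.codeFst]

@[simp]
theorem codeSnd_pair (a b : ℕ) : (Nat.pair a b).codeSnd = b := by simp [Nat.codeSnd]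

section PrimrecTools

attribute [fun_prop] Primrec
attribute [fun_prop] Primrec.id Primrec.const Primrec.comp Primrec.pair

variable {α β : Type} [Primcodable α] [Primcodable β] {f g : α → ℕ}

@[fun_prop]
theorem primrec_fst {γ : Type} [Primcodable γ] {u : γ → α × β} (hu : Primrec u) :
    Primrec fun a => (u a).1 :=
  Primrec.fst.comp hu

@[fun_prop]
theorem primrec_snd {γ : Type} [Primcodable γ] {u : γ → α × β} (hu : Primrec u) :
    Primrec fun a => (u a).2 :=
  Primrec.snd.comp hu

@[fun_prop]
theorem primrec_pair (hf : Primrec f) (hg : Primrec g) : Primrec fun a => Nat.pair (f a) (g a) :=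
  Primrec₂.natPair.comp hf hg

@[fun_prop]
theorem primrec_codeFst (hf : Primrec f) : Primrec fun a => (f a).codeFst :=
  Primrec.fst.comp (Primrec.unpair.comp hf)

@[fun_prop]
theorem primrec_codeSnd (hf : Primrec f) : Primrec fun a => (f a).codeSnd :=
  Primrec.snd.comp (Primrec.unpair.comp hf)

@[fun_prop]
theorem primrec_add (hf : Primrec f) (hg : Primrec g) : Primrec fun a => f a + g a :=
  Primrec.nat_add.comp hf hg

@[fun_prop]
theorem primrec_mul (hf : Primrec f) (hg : Primrec g) : Primrec fun a => f a * g a :=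
  Primrec.nat_mul.comp hf hg

@[fun_prop]
theorem primrec_div (hf : Primrec f) (hg : Primrec g) : Primrec fun a => f a / g a :=
  Primrec.nat_div.comp hf hg

@[fun_prop]
theorem primrec_mod (hf : Primrec f) (hg : Primrec g) : Primrec fun a => f a % g a :=
  Primrec.nat_mod.comp hf hg

@[fun_prop]
theorem primrec_pow (hf : Primrec f) (hg : Primrec g) : Primrec fun a => f a ^ g a :=
  (Primrec₂.unpaired'.1 Nat.Primrec.pow).comp hf hg

@[fun_prop]
theorem primrec_ite_eq {s t : α → β} (hf : Primrec f) (hg : Primrec g) (hs : Primrec s)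
    (ht : Primrec t) : Primrec fun a => if f a = g a then s a else t a :=
  Primrec.ite (Primrec.eq.comp hf hg) hs ht

@[fun_prop]
theorem primrec_ite_bool {b : α → Bool} {s t : α → β} (hb : Primrec b) (hs : Primrec s)
    (ht : Primrec t) : Primrec fun a => if b a = true then s a else t a :=
  Primrec.ite (Primrec.eq.comp hb (Primrec.const true)) hs ht

@[fun_prop]
theorem primrec_ite_lt {s t : α → β} (hf : Primrec f) (hg : Primrec g) (hs : Primrec s)
    (ht : Primrec t) : Primrec fun a => if f a < g a then s a else t a :=
  Primrec.ite (Primrec.nat_lt.comp hf hg) hs ht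

/-- Recursion along two functions `l` and `r`, as far as they decrease. -/
def treeRec {α : Type} (G : α → ℕ → ℕ → ℕ → ℕ) (l r : ℕ → ℕ) (a : α) (n : ℕ) : ℕ :=
  G a n (if l n < n then treeRec G l r a (l n) else 0)
    (if r n < n then treeRec G l r a (r n) else 0)
termination_by n

/-- Course-of-values recursion: both recursive calls go to smaller arguments, so their results can
be looked up in the list of earlier values. -/
theorem primrec_treeRec {G : α → ℕ → ℕ → ℕ → ℕ} {l r : ℕ → ℕ}
    (hG : Primrec fun p : α × ℕ × ℕ × ℕ => G p.1 p.2.1 p.2.2.1 p.2.2.2)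
    (hl : Primrec l) (hr : Primrec r) : Primrec₂ (treeRec G l r) := by
  have get : ∀ {s : ℕ → ℕ}, Primrec s → Primrec fun p : α × List ℕ =>
      if s p.2.length < p.2.length then p.2.getD (s p.2.length) 0 else 0 := by
    intro s hs
    have hlen : Primrec fun p : α × List ℕ => p.2.length := Primrec.list_length.comp Primrec.snd
    have hget : Primrec fun p : α × List ℕ => p.2.getD (s p.2.length) 0 :=
      (Primrec.list_getD 0).comp Primrec.snd (hs.comp hlen)
    fun_prop
  -- At stage `n` the list `L` holds the values at `0, …, n - 1`, so `L.length` plays the role of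
  -- `n`.
  refine Primrec.nat_strong_rec (treeRec G l r)
    (g := fun a L => some (G a L.length
      (if l L.length < L.length then L.getD (l L.length) 0 else 0)
      (if r L.length < L.length then L.getD (r L.length) 0 else 0))) ?_ ?_
  · refine Primrec.option_some.comp (hG.comp (Primrec.fst.pair
      ((Primrec.list_length.comp Primrec.snd).pair ((get hl).pair (get hr)))))
  · intro a n
    rw [treeRec]
    simp only [List.length_map, List.length_range, Option.some.injEq]
    congr 1
    · split_ifs with hn
      · simp [hn]
      · rfl
    · split_ifs with hn
      · simp [hn]
      · rfl

/-- Every constructor with subterms has a nonzero tag, so codes of subterms are strictly smaller and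
the tests `l n < n`, `r n < n` in `treeRec` succeed on genuine codes. -/
theorem lt_pair_right {a : ℕ} (b : ℕ) (ha : a ≠ 0) : b < Nat.pair a b := by
  have : 1 ≤ a := Nat.one_le_iff_ne_zero.2 ha
  unfold Nat.pair
  split_ifs <;> nlinarith

/-- The list of numbers with a given code. -/
def listOf (n : ℕ) : List ℕ := (Encodable.decode (α := List ℕ) n).getD []

@[simp]
theorem listOf_encode (L : List ℕ) : listOf (Encodable.encode L) = L := by
  simp [listOf]

theorem primrec_listOf : Primrec listOf :=
  Primrec.option_getD.comp Primrec.decode (Primrec.const [])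

theorem primrec_foldr_listOf {g : α → ℕ → ℕ → ℕ} {s t : α → ℕ}
    (hg : Primrec fun p : α × ℕ × ℕ => g p.1 p.2.1 p.2.2) (hs : Primrec s) (ht : Primrec t) :
    Primrec fun a => (listOf (s a)).foldr (g a) (t a) :=
  Primrec.list_foldr (primrec_listOf.comp hs) ht (h := fun a p => g a p.1 p.2) hg

end PrimrecTools

/-! ### Evaluation on codes -/

/-- The pointer structure with number `z` has the carriers `{0, …, size z p}`. -/
def size (z : ℕ) : PSort → ℕ
  | .train => z.codeFst
  | .seg => z.codeSnd.codeFst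

def sizeCode (z k : ℕ) : ℕ := if k = 0 then z.codeFst else z.codeSnd.codeFst

theorem sizeCode_code (z : ℕ) (p : PSort) : sizeCode z p.code = size z p := by
  cases p <;> simp [sizeCode, PSort.code, size]

@[fun_prop]
theorem primrec_sizeCode {α : Type} [Primcodable α] {f g : α → ℕ} (hf : Primrec f)
    (hg : Primrec g) : Primrec fun a => sizeCode (f a) (g a) := by
  unfold sizeCode; fun_prop

/-- A base for tables of elements. -/
def base (z : ℕ) : ℕ := z.codeFst + z.codeSnd.codeFst + 1

@[fun_prop]
theorem primrec_base {α : Type} [Primcodable α] {f : α → ℕ} (hf : Primrec f) :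
    Primrec fun a => base (f a) := by
  unfold base; fun_prop

/-- The `k`-th digit of `x`. -/
def digit (b x k : ℕ) : ℕ := x / b ^ k % b

@[fun_prop]
theorem primrec_digit {α : Type} [Primcodable α] {f g h : α → ℕ} (hf : Primrec f)
    (hg : Primrec g) (hh : Primrec h) : Primrec fun a => digit (f a) (g a) (h a) := by
  unfold digit; fun_prop

/-- The entry with number `k` of the table of the functions of the structure `z`. -/
def entry (z k : ℕ) : ℕ := digit (base z) z.codeSnd.codeSnd k

@[fun_prop]
theorem primrec_entry {α : Type} [Primcodable α] {f g : α → ℕ} (hf : Primrec f)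
    (hg : Primrec g) : Primrec fun a => entry (f a) (g a) := by
  unfold entry; fun_prop

/-- The code of the sort of a constant. -/
def constSort (c : ℕ) : ℕ :=
  if c.codeFst = 0 then c.codeSnd.codeFst else
  if c.codeFst = 1 then 1 else if c.codeFst = 5 then 1 else 0

theorem constSort_code {p : PSort} (c : PConst p) : constSort c.code = p.code := by
  cases c <;> simp [constSort, PConst.code, PSort.code]

@[fun_prop]
theorem primrec_constSort {α : Type} [Primcodable α] {f : α → ℕ} (hf : Primrec f) :
    Primrec fun a => constSort (f a) := by
  unfold constSort; fun_prop

/-- The code of the target sort of a function symbol. -/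
def targetSort (f : ℕ) : ℕ :=
  if f.codeFst = 0 then 1 else if f.codeFst = 1 then 1 else if f.codeFst = 4 then 1 else 0

theorem targetSort_code {p q : PSort} (f : PSym p q) : targetSort f.code = q.code := by
  cases f <;> simp [targetSort, PSym.code, PSort.code]

@[fun_prop]
theorem primrec_targetSort {α : Type} [Primcodable α] {f : α → ℕ} (hf : Primrec f) :
    Primrec fun a => targetSort (f a) := by
  unfold targetSort; fun_prop

/-- Priming of a symbol of which `m` is the first one that may change, if `b` holds. -/
def primeCode (m : ℕ) (b : Bool) (f : ℕ) : ℕ :=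
  if b = true then if f.codeFst < m then f else Nat.pair f.codeFst 1 else f

def PSym.primeIf (b : Bool) {p q : PSort} (f : PSym p q) : PSym p q := if b then f.prime else f

def SSym.primeIf (b : Bool) {p : PSort} {σ : SSort} (f : SSym p σ) : SSym p σ :=
  if b then f.prime else f

/-- The static pointer functions are exactly those with tags 0 and 1. For scalar-valued functions
the static tags are 0 to 3, hence the parameters 2 and 4 of `primeCode`. -/
theorem PSym.code_primeIf (b : Bool) {p q : PSort} (f : PSym p q) :
    (f.primeIf b).code = primeCode 2 b f.code := by
  cases b <;> cases f <;> simp [PSym.primeIf, PSym.prime, primeCode, PSym.code]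

theorem SSym.code_primeIf (b : Bool) {p : PSort} {σ : SSort} (f : SSym p σ) :
    (f.primeIf b).code = primeCode 4 b f.code := by
  cases b <;> cases f <;> simp [SSym.primeIf, SSym.prime, primeCode, SSym.code]

@[fun_prop]
theorem primrec_primeCode (m : ℕ) {α : Type} [Primcodable α] {f : α → ℕ} {b : α → Bool}
    (hf : Primrec f) (hb : Primrec b) : Primrec fun a => primeCode m (b a) (f a) := by
  unfold primeCode; fun_prop

/-- A structure, a valuation, and whether symbols are to be primed. -/
abbrev Env : Type := ℕ × ℕ × Bool

/-- The value of a pointer term, on codes. -/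
def evalCode : Env → ℕ → ℕ :=
  treeRec (fun a n u _ =>
    if n.codeFst = 0 then
      digit (base a.1) a.2.1 n.codeSnd % (sizeCode a.1 n.codeSnd.codeFst + 1)
    else if n.codeFst = 1 then
      entry a.1 (Nat.pair 0 n.codeSnd) % (sizeCode a.1 (constSort n.codeSnd) + 1)
    else if n.codeFst = 2 then 0
    else entry a.1 (Nat.pair 1 (Nat.pair (primeCode 2 a.2.2 n.codeSnd.codeFst) u)) %
      (sizeCode a.1 (targetSort n.codeSnd.codeFst) + 1))
    (fun n => n.codeSnd.codeSnd) (fun _ => 0)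

@[fun_prop]
theorem primrec_evalCode {α : Type} [Primcodable α] {f : α → Env} {g : α → ℕ} (hf : Primrec f)
    (hg : Primrec g) : Primrec fun a => evalCode (f a) (g a) := by
  refine (primrec_treeRec ?_ ?_ ?_).comp hf hg <;> fun_prop

/-- The constant put in place of an atomic term, on codes. -/
def atomCode (a : Env) (n : ℕ) : ℕ :=
  if n.codeFst = 0 then n
  else if n.codeFst = 1 then if a.2.2 = true then Nat.pair 1 1 else n
  else Nat.pair 2 (Nat.pair (primeCode 4 a.2.2 n.codeSnd.codeFst)
    (evalCode a n.codeSnd.codeSnd))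

@[fun_prop]
theorem primrec_atomCode {α : Type} [Primcodable α] {f : α → Env} {g : α → ℕ} (hf : Primrec f)
    (hg : Primrec g) : Primrec fun a => atomCode (f a) (g a) := by
  unfold atomCode; fun_prop

/-- Replacement of atomic terms in a scalar term, on codes. -/
def termCode : Env → ℕ → ℕ :=
  treeRec (fun a n u w =>
    if n.codeFst = 1 then Nat.pair 1 (atomCode a n.codeSnd)
    else if n.codeFst = 4 then Nat.pair 4 (Nat.pair n.codeSnd.codeFst (Nat.pair u w))
    else if n.codeFst = 6 then Nat.pair 6 w
    else n)
    -- The position of a subterm depends on the tag: a binary operation stores its operator before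
    -- the two arguments, while `bd` (tag 6) stores its argument directly. Values read at a wrong
    -- position are ignored by the step function.
    (fun n => n.codeSnd.codeSnd.codeFst)
    (fun n => if n.codeFst = 4 then n.codeSnd.codeSnd.codeSnd else n.codeSnd)

@[fun_prop]
theorem primrec_termCode {α : Type} [Primcodable α] {f : α → Env} {g : α → ℕ} (hf : Primrec f)
    (hg : Primrec g) : Primrec fun a => termCode (f a) (g a) := by
  refine (primrec_treeRec ?_ ?_ ?_).comp hf hg <;> fun_prop

/-- Replacement of atomic terms in a scalar formula, on codes. -/
def formCode : Env → ℕ → ℕ :=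
  treeRec (fun a n u w =>
    if n.codeFst = 1 then Nat.pair 1 (Nat.pair n.codeSnd.codeFst
      (Nat.pair n.codeSnd.codeSnd.codeFst
        (Nat.pair (termCode a n.codeSnd.codeSnd.codeSnd.codeFst)
          (termCode a n.codeSnd.codeSnd.codeSnd.codeSnd))))
    else if n.codeFst = 2 then Nat.pair 2 w
    else if n.codeFst = 3 then Nat.pair 3 (Nat.pair u w)
    else if n.codeFst = 4 then Nat.pair 4 (Nat.pair n.codeSnd.codeFst
      (Nat.pair n.codeSnd.codeSnd.codeFst w))
    else n)
    (fun n => n.codeSnd.codeFst)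
    (fun n => if n.codeFst = 2 then n.codeSnd else
      if n.codeFst = 3 then n.codeSnd.codeSnd else n.codeSnd.codeSnd.codeSnd)

@[fun_prop]
theorem primrec_formCode {α : Type} [Primcodable α] {f : α → Env} {g : α → ℕ} (hf : Primrec f)
    (hg : Primrec g) : Primrec fun a => formCode (f a) (g a) := by
  refine (primrec_treeRec ?_ ?_ ?_).comp hf hg <;> fun_prop

/-! ### Evaluation on codes agrees with evaluation -/

theorem treeRec_eq {α : Type} {G : α → ℕ → ℕ → ℕ → ℕ} {l r : ℕ → ℕ} {a : α} {n : ℕ} :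
    treeRec G l r a n = G a n (if l n < n then treeRec G l r a (l n) else 0)
      (if r n < n then treeRec G l r a (r n) else 0) := by
  rw [treeRec]

/-- The constants put in place of the atomic terms. -/
def atomMap (a : Env) (σ : SSort) (u : Atom σ) : ℕ := atomCode a (Atom.code σ u)

theorem code_term_map (a : Env) {σ : SSort} (t : STerm Atom σ) :
    (t.map (atomMap a)).code (fun _ i => i) = termCode a (t.code Atom.code) := by
  induction t with
  | bin o s t hs ht =>
    have h1 : s.code Atom.code < (STerm.bin o s t).code Atom.code :=
      ((Nat.left_le_pair _ _).trans (Nat.right_le_pair _ _)).trans_lt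
        (lt_pair_right _ (by norm_num))
    have h2 : t.code Atom.code < (STerm.bin o s t).code Atom.code :=
      ((Nat.right_le_pair _ _).trans (Nat.right_le_pair _ _)).trans_lt
        (lt_pair_right _ (by norm_num))
    rw [termCode, treeRec_eq]
    simp only [STerm.code, STerm.map, codeFst_pair, codeSnd_pair] at h1 h2 ⊢
    simp [h1, h2, hs, ht, termCode]
  | bd t ht =>
    have h2 : t.code Atom.code < (STerm.bd t).code Atom.code := lt_pair_right _ (by norm_num)
    rw [termCode, treeRec_eq]
    simp only [STerm.code, STerm.map, codeFst_pair, codeSnd_pair] at h2 ⊢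
    simp [h2, ht, termCode]
  | _ => rw [termCode, treeRec_eq]; simp [STerm.code, STerm.map, atomMap]

/-- Structural induction. In each recursive case the bounds `h1`, `h2` show that the calls of
`treeRec` on the subformulas are really made. -/
theorem code_form_map (a : Env) (φ : SForm Atom) :
    (φ.map (atomMap a)).code (fun _ i => i) = formCode a (φ.code Atom.code) := by
  induction φ with
  | falsum => rw [formCode, treeRec_eq]; simp [SForm.code, SForm.map]
  | rel r s t => rw [formCode, treeRec_eq]; simp [SForm.code, SForm.map, code_term_map]
  | neg φ h =>
    have h2 : φ.code Atom.code < (SForm.neg φ).code Atom.code := lt_pair_right _ (by norm_num)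
    rw [formCode, treeRec_eq]
    simp only [SForm.code, SForm.map, codeFst_pair, codeSnd_pair] at h2 ⊢
    simp [h2, h, formCode]
  | and φ ψ hφ hψ =>
    have h1 : φ.code Atom.code < (SForm.and φ ψ).code Atom.code :=
      (Nat.left_le_pair _ _).trans_lt (lt_pair_right _ (by norm_num))
    have h2 : ψ.code Atom.code < (SForm.and φ ψ).code Atom.code :=
      (Nat.right_le_pair _ _).trans_lt (lt_pair_right _ (by norm_num))
    rw [formCode, treeRec_eq]
    simp only [SForm.code, SForm.map, codeFst_pair, codeSnd_pair] at h1 h2 ⊢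
    simp [h1, h2, hφ, hψ, formCode]
  | all σ i φ h =>
    have h2 : φ.code Atom.code < (SForm.all σ i φ).code Atom.code :=
      ((Nat.right_le_pair _ _).trans (Nat.right_le_pair _ _)).trans_lt
        (lt_pair_right _ (by norm_num))
    rw [formCode, treeRec_eq]
    simp only [SForm.code, SForm.map, codeFst_pair, codeSnd_pair] at h2 ⊢
    simp [h2, h, formCode]

/-- The structure with number `z`, for given values `c` of the scalar constants that stand for the
atomic terms. -/
def tableStr (S : ScalarStr) (z : ℕ) (c : ∀ σ, ℕ → S.carrier σ) : Str S where
  carrier p := Fin (size z p + 1)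
  null _ := 0
  pconst p k := Fin.ofNat (size z p + 1) (entry z (Nat.pair 0 k.code))
  pfun _ q f d := Fin.ofNat (size z q + 1) (entry z (Nat.pair 1 (Nat.pair f.code d.val)))
  sconst σ i := c σ (Nat.pair 0 (Nat.pair σ.code i))
  pc b := c .int (Nat.pair 1 b.toNat)
  sfun _ σ f d := c σ (Nat.pair 2 (Nat.pair f.code d.val))

/-- The valuation with number `y`. -/
def valuation (z y : ℕ) (p : PSort) (i : ℕ) : Fin (size z p + 1) :=
  Fin.ofNat (size z p + 1) (digit (base z) y (Nat.pair p.code i))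

/-- If `b` holds, the reduct in which all symbols are interpreted as the primed ones. -/
def Str.primeIf {S : ScalarStr} (b : Bool) (M : Str S) : Str S where
  carrier := M.carrier
  null := M.null
  pconst := M.pconst
  pfun p q f := M.pfun p q (f.primeIf b)
  sconst := M.sconst
  pc x := M.pc (b || x)
  sfun p σ f := M.sfun p σ (f.primeIf b)

section

variable (S : ScalarStr) (z y : ℕ) (b : Bool) (c : ∀ σ, ℕ → S.carrier σ)

/-- The remainder modulo `size + 1` in `evalCode` is the reduction made by `Fin.ofNat` in
`tableStr`. Hence every number `z` describes a structure, and no well-formedness test on tables is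
needed. -/
theorem evalCode_code {p : PSort} (t : PTerm p) :
    evalCode (z, y, b) t.code =
      (t.eval ((tableStr S z c).primeIf b) (valuation z y) : Fin (size z p + 1)).val := by
  induction t with
  | var p i =>
    rw [evalCode, treeRec_eq]
    simp [PTerm.code, PTerm.eval, valuation, sizeCode_code]
  | const k =>
    rw [evalCode, treeRec_eq]
    simp [PTerm.code, PTerm.eval, Str.primeIf, tableStr, constSort_code, sizeCode_code]
  | null p =>
    rw [evalCode, treeRec_eq]
    simp [PTerm.code, PTerm.eval, Str.primeIf, tableStr]
  | app f t h =>
    have h1 : t.code < (PTerm.app f t).code :=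
      (Nat.right_le_pair _ _).trans_lt (lt_pair_right _ (by norm_num))
    rw [evalCode, treeRec_eq]
    simp only [PTerm.code, codeFst_pair, codeSnd_pair] at h1 ⊢
    rw [if_pos h1, ← evalCode, h]
    simp [PTerm.eval, Str.primeIf, tableStr, targetSort_code, sizeCode_code,
      ← PSym.code_primeIf]

/-- `atomCode` keeps the shape of the code of an atom and replaces the code of its pointer argument
by the number of an element. `tableStr` reads its scalars from constants named in the same way. -/
theorem atom_eval_tableStr {σ : SSort} (u : Atom σ) :
    u.eval ((tableStr S z c).primeIf b) (valuation z y) = c σ (atomMap (z, y, b) σ u) := by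
  cases u with
  | const σ i => simp [Atom.eval, Str.primeIf, tableStr, atomMap, Atom.code, atomCode]
  | pc x =>
    cases b <;> cases x <;> simp [Atom.eval, Str.primeIf, tableStr, atomMap, Atom.code, atomCode]
  | field f t =>
    simp [Atom.eval, Str.primeIf, tableStr, atomMap, Atom.code, atomCode, evalCode_code S z y b c,
      ← SSym.code_primeIf]

end

/-! ### Scalar formulas -/

section Scalar

variable {A B : SSort → Type} {S : ScalarStr}

theorem STerm.eval_map (θ : ∀ σ, A σ → B σ) (α : ∀ σ, B σ → S.carrier σ)
    (v : ∀ x : SSort × ℕ, S.carrier x.1) {σ : SSort} (t : STerm A σ) :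
    (t.map θ).eval S α v = t.eval S (fun σ a => α σ (θ σ a)) v := by
  induction t <;> simp_all [STerm.map, STerm.eval]

theorem SForm.holds_map (θ : ∀ σ, A σ → B σ) (α : ∀ σ, B σ → S.carrier σ)
    (v : ∀ x : SSort × ℕ, S.carrier x.1) (φ : SForm A) :
    (φ.map θ).Holds S α v ↔ φ.Holds S (fun σ a => α σ (θ σ a)) v := by
  induction φ generalizing v <;> simp_all [SForm.map, SForm.Holds, STerm.eval_map]

theorem STerm.eval_congr {α β : ∀ σ, A σ → S.carrier σ} {v w : ∀ x : SSort × ℕ, S.carrier x.1}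
    {σ : SSort} (t : STerm A σ) (h : ∀ x ∈ t.atoms, α x.1 x.2 = β x.1 x.2)
    (hv : ∀ x ∈ t.vars, v x = w x) : t.eval S α v = t.eval S β w := by
  induction t with
  | var σ i => exact hv _ rfl
  | atom a => exact h ⟨_, a⟩ (List.mem_singleton_self _)
  | bin o s t hs ht =>
    simp only [STerm.eval]
    rw [hs (fun x hx => h x (List.mem_append_left _ hx)) (fun x hx => hv x (Or.inl hx)),
      ht (fun x hx => h x (List.mem_append_right _ hx)) (fun x hx => hv x (Or.inr hx))]
  | bd t ht => simp only [STerm.eval]; rw [ht h hv]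
  | _ => rfl

theorem SForm.holds_congr {α β : ∀ σ, A σ → S.carrier σ} {v w : ∀ x : SSort × ℕ, S.carrier x.1}
    (φ : SForm A) (h : ∀ x ∈ φ.atoms, α x.1 x.2 = β x.1 x.2) (hv : ∀ x ∈ φ.free, v x = w x) :
    φ.Holds S α v ↔ φ.Holds S β w := by
  induction φ generalizing v w with
  | falsum => rfl
  | rel r s t =>
    simp only [SForm.Holds]
    rw [s.eval_congr (fun x hx => h x (List.mem_append_left _ hx)) (fun x hx => hv x (Or.inl hx)),
      t.eval_congr (fun x hx => h x (List.mem_append_right _ hx)) (fun x hx => hv x (Or.inr hx))]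
  | neg φ hφ => simp only [SForm.Holds]; rw [hφ h hv]
  | and φ ψ hφ hψ =>
    simp only [SForm.Holds]
    rw [hφ (fun x hx => h x (List.mem_append_left _ hx)) (fun x hx => hv x (Or.inl hx)),
      hψ (fun x hx => h x (List.mem_append_right _ hx)) (fun x hx => hv x (Or.inr hx))]
  | all σ i φ hφ =>
    simp only [SForm.Holds]
    refine forall_congr' fun a => hφ h fun x hx => ?_
    by_cases hxi : x = (σ, i)
    · subst hxi; simp
    · rw [Function.update_of_ne hxi, Function.update_of_ne hxi]
      exact hv x ⟨hx, hxi⟩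

theorem SForm.Closed.holds_iff {φ : SForm A} (h : φ.Closed) (α : ∀ σ, A σ → S.carrier σ)
    (v w : ∀ x : SSort × ℕ, S.carrier x.1) : φ.Holds S α v ↔ φ.Holds S α w :=
  φ.holds_congr (fun _ _ => rfl) fun x hx => by rw [h] at hx; exact hx.elim

def SForm.top : SForm A := .neg .falsum

theorem SForm.holds_top (α : ∀ σ, A σ → S.carrier σ) (v : ∀ x : SSort × ℕ, S.carrier x.1) :
    (SForm.top : SForm A).Holds S α v := id

/-- The conjunction of `g 0, …, g (n - 1)`. -/
def SForm.conjBelow (g : ℕ → SForm A) : ℕ → SForm A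
  | 0 => .top
  | n + 1 => .and (conjBelow g n) (g n)

theorem SForm.holds_conjBelow (α : ∀ σ, A σ → S.carrier σ) (v : ∀ x : SSort × ℕ, S.carrier x.1)
    (g : ℕ → SForm A) (n : ℕ) :
    (SForm.conjBelow g n).Holds S α v ↔ ∀ i < n, (g i).Holds S α v := by
  induction n with
  | zero => simp [conjBelow, SForm.holds_top]
  | succ n ih =>
    simp only [conjBelow, SForm.Holds, ih, Nat.lt_succ_iff_lt_or_eq]
    constructor
    · rintro ⟨h1, h2⟩ i (hi | rfl)
      · exact h1 i hi
      · exact h2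
    · exact fun h => ⟨fun i hi => h i (Or.inl hi), h n (Or.inr rfl)⟩

def conjBelowCode (g : ℕ → ℕ) (n : ℕ) : ℕ :=
  Nat.rec (Nat.pair 2 (Nat.pair 0 0)) (fun i u => Nat.pair 3 (Nat.pair u (g i))) n

theorem SForm.code_conjBelow (κ : ∀ σ, A σ → ℕ) (g : ℕ → SForm A) (n : ℕ) :
    (SForm.conjBelow g n).code κ = conjBelowCode (fun i => (g i).code κ) n := by
  induction n with
  | zero => rfl
  | succ n ih => simp [conjBelow, SForm.code, ih, conjBelowCode]

theorem primrec_conjBelowCode {α : Type} [Primcodable α] {g : α → ℕ → ℕ} {f : α → ℕ}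
    (hg : Primrec fun p : α × ℕ => g p.1 p.2) (hf : Primrec f) :
    Primrec fun a => conjBelowCode (g a) (f a) := by
  refine Primrec.nat_rec' (h := fun a p => Nat.pair 3 (Nat.pair p.2 (g a p.1))) hf
    (Primrec.const _) ?_
  have : Primrec fun p : α × ℕ × ℕ => g p.1 p.2.1 := hg.comp (by fun_prop : Primrec
    fun p : α × ℕ × ℕ => (p.1, p.2.1))
  unfold Primrec₂
  fun_prop

end Scalar

/-! ### Instances of clauses -/

/-- The instance of a clause in a table structure, as a scalar formula. -/
def inst (a : Env) (c : Clause) : ScalarFormula :=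
  c.pos.foldr (fun e φ => if evalCode a e.lhs.code = evalCode a e.rhs.code then .top else φ)
    (c.neg.foldr (fun e φ => if evalCode a e.lhs.code = evalCode a e.rhs.code then φ else .top)
      (c.body.map (atomMap a)))

/-- `Nat.pair 2 (Nat.pair 0 0)` is the code of `SForm.top`. -/
def instCode (a : Env) (n : ℕ) : ℕ :=
  (listOf n.codeFst).foldr (fun e u =>
      if evalCode a e.codeSnd.codeFst = evalCode a e.codeSnd.codeSnd then
        Nat.pair 2 (Nat.pair 0 0) else u)
    ((listOf n.codeSnd.codeFst).foldr (fun e u =>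
        if evalCode a e.codeSnd.codeFst = evalCode a e.codeSnd.codeSnd then u
        else Nat.pair 2 (Nat.pair 0 0))
      (formCode a n.codeSnd.codeSnd))

theorem code_inst (a : Env) (c : Clause) :
    ScalarFormula.code (inst a c) = instCode a c.code := by
  simp only [instCode, Clause.code, codeFst_pair, codeSnd_pair, listOf_encode, List.foldr_map, PEq.code, inst]
  induction c.pos with
  | nil =>
    simp only [List.foldr_nil]
    induction c.neg with
    | nil => exact code_form_map a c.body
    | cons e L ih =>
      simp only [List.foldr_cons]
      split_ifs
      · exact ih
      · rfl
  | cons e L ih =>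
    simp only [List.foldr_cons]
    split_ifs
    · rfl
    · exact ih

@[fun_prop]
theorem primrec_instCode {α : Type} [Primcodable α] {f : α → Env} {g : α → ℕ} (hf : Primrec f)
    (hg : Primrec g) : Primrec fun a => instCode (f a) (g a) := by
  have hl : Primrec fun q : (Env × ℕ) × ℕ × ℕ => evalCode q.1.1 q.2.1.codeSnd.codeFst :=
    primrec_evalCode (by fun_prop) (by fun_prop)
  have hr : Primrec fun q : (Env × ℕ) × ℕ × ℕ => evalCode q.1.1 q.2.1.codeSnd.codeSnd :=
    primrec_evalCode (by fun_prop) (by fun_prop)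
  have hs : Primrec fun q : (Env × ℕ) × ℕ × ℕ => q.2.2 := by fun_prop
  have h1 := primrec_ite_eq hl hr (Primrec.const (Nat.pair 2 (Nat.pair 0 0))) hs
  have h2 := primrec_ite_eq hl hr hs (Primrec.const (Nat.pair 2 (Nat.pair 0 0)))
  have h3 : Primrec fun p : Env × ℕ => formCode p.1 p.2.codeSnd.codeSnd := by fun_prop
  have h4 : Primrec fun p : Env × ℕ => p.2.codeFst := by fun_prop
  have h5 : Primrec fun p : Env × ℕ => p.2.codeSnd.codeFst := by fun_prop
  have : Primrec fun p : Env × ℕ => instCode p.1 p.2 := primrec_foldr_listOf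
    (g := fun (p : Env × ℕ) e u =>
      if evalCode p.1 e.codeSnd.codeFst = evalCode p.1 e.codeSnd.codeSnd then
        Nat.pair 2 (Nat.pair 0 0) else u) h1 h4 (primrec_foldr_listOf
    (g := fun (p : Env × ℕ) e u =>
      if evalCode p.1 e.codeSnd.codeFst = evalCode p.1 e.codeSnd.codeSnd then
        u else Nat.pair 2 (Nat.pair 0 0)) h2 h5 h3)
  exact this.comp (hf.pair hg)

/-- Truth of the matrix of a clause. -/
def Clause.Matrix {S : ScalarStr} (c : Clause) (M : Str S) (w : ∀ p, ℕ → M.carrier p)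
    (v : ∀ x : SSort × ℕ, S.carrier x.1) : Prop :=
  (∃ e ∈ c.pos, e.Holds M w) ∨ (∃ e ∈ c.neg, ¬ e.Holds M w) ∨ c.body.Holds S (Atom.eval M w) v

/-- The equalities are decided while the formula is built: a true literal turns the whole
disjunction into `SForm.top`, a false one is dropped. The predicate `P` abstracts the truth of an
equality, so that the induction does not depend on the structure. -/
theorem holds_inst_iff {S : ScalarStr} {a : Env} {k : ∀ σ, ℕ → S.carrier σ}
    {v : ∀ x : SSort × ℕ, S.carrier x.1} {P : PEq → Prop}
    (hP : ∀ e : PEq, evalCode a e.lhs.code = evalCode a e.rhs.code ↔ P e) (c : Clause) :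
    SForm.Holds S k v (inst a c) ↔ (∃ e ∈ c.pos, P e) ∨ (∃ e ∈ c.neg, ¬ P e) ∨
      SForm.Holds S k v (c.body.map (atomMap a)) := by
  unfold inst
  induction c.pos with
  | nil =>
    simp only [List.foldr_nil, List.not_mem_nil, false_and, exists_false, false_or]
    induction c.neg with
    | nil => simp
    | cons e L ih =>
      simp only [List.foldr_cons, List.mem_cons, exists_eq_or_imp]
      split_ifs with h
      · rw [ih]; simp [(hP e).1 h]
      · simp [mt (hP e).2 h, SForm.holds_top]
  | cons e L ih =>
    simp only [List.foldr_cons, List.mem_cons, exists_eq_or_imp]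
    split_ifs with h
    · simp [(hP e).1 h, SForm.holds_top]
    · rw [ih]; simp [mt (hP e).2 h]

theorem holds_inst (S : ScalarStr) (z y : ℕ) (b : Bool) (k : ∀ σ, ℕ → S.carrier σ)
    (v : ∀ x : SSort × ℕ, S.carrier x.1) (c : Clause) :
    SForm.Holds S k v (inst (z, y, b) c) ↔
      c.Matrix ((tableStr S z k).primeIf b) (valuation z y) v := by
  have hatom : (fun σ (u : Atom σ) => k σ (atomMap (z, y, b) σ u)) =
      Atom.eval ((tableStr S z k).primeIf b) (valuation z y) := by
    funext σ u
    exact (atom_eval_tableStr S z y b k u).symm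
  have h := holds_inst_iff (k := k) (v := v) (a := (z, y, b))
    (P := fun e => e.Holds ((tableStr S z k).primeIf b) (valuation z y)) (fun e => by
      rw [evalCode_code S z y b k, evalCode_code S z y b k]
      exact Fin.val_inj) c
  rw [SForm.holds_map, hatom] at h
  exact h

/-! ### Bounds for codes -/

theorem pair_le_pair {a a' b b' : ℕ} (ha : a ≤ a') (hb : b ≤ b') :
    Nat.pair a b ≤ Nat.pair a' b' := by
  have h1 : Nat.pair a b ≤ Nat.pair a' b := by
    rcases ha.eq_or_lt with rfl | h
    · exact le_rfl
    · exact (Nat.pair_lt_pair_left b h).le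
  have h2 : Nat.pair a' b ≤ Nat.pair a' b' := by
    rcases hb.eq_or_lt with rfl | h
    · exact le_rfl
    · exact (Nat.pair_lt_pair_right a' h).le
  exact h1.trans h2

theorem le_encode_of_mem {x : ℕ} {L : List ℕ} (h : x ∈ L) : x ≤ Encodable.encode L := by
  induction L with
  | nil => simp at h
  | cons a L ih =>
    rw [Encodable.encode_list_cons]
    rcases List.mem_cons.1 h with rfl | h
    · exact (Nat.left_le_pair _ _).trans (Nat.le_succ _)
    · exact (ih h).trans ((Nat.right_le_pair _ _).trans (Nat.le_succ _))

theorem PTerm.code_le_of_mem_subs {p : PSort} (t : PTerm p) {u : Sigma PTerm} (h : u ∈ t.subs) :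
    u.2.code ≤ t.code := by
  induction t with
  | app f t ih =>
    rcases List.mem_cons.1 h with rfl | h
    · exact le_rfl
    · exact (ih h).trans ((Nat.right_le_pair _ _).trans (Nat.right_le_pair _ _))
  | _ => obtain rfl := List.mem_singleton.1 h; exact le_rfl

theorem PTerm.mem_subs_self {p : PSort} (t : PTerm p) : ⟨p, t⟩ ∈ t.subs := by
  cases t <;> simp [PTerm.subs]

theorem PTerm.mem_subs_of_mem_proper {p : PSort} (t : PTerm p) {u : Sigma PTerm}
    (h : u ∈ t.proper) : u ∈ t.subs := by
  cases t with
  | app f t => exact List.mem_cons_of_mem _ h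
  | _ => simp [PTerm.proper] at h

theorem Atom.code_le_of_mem_subs {σ : SSort} (a : Atom σ) {u : Sigma PTerm} (h : u ∈ a.subs) :
    u.2.code ≤ Atom.code σ a := by
  cases a with
  | field f t =>
    exact (t.code_le_of_mem_subs h).trans ((Nat.right_le_pair _ _).trans (Nat.right_le_pair _ _))
  | _ => simp [Atom.subs] at h

theorem STerm.code_le_of_mem_atoms {σ : SSort} (t : STerm Atom σ) {x : Sigma Atom}
    (h : x ∈ t.atoms) : Atom.code x.1 x.2 ≤ t.code Atom.code := by
  induction t with
  | atom a =>
    obtain rfl := List.mem_singleton.1 h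
    exact Nat.right_le_pair _ _
  | bin o s t hs ht =>
    refine le_trans ?_ ((Nat.right_le_pair _ _).trans (Nat.right_le_pair _ _))
    rcases List.mem_append.1 h with h | h
    · exact (hs h).trans (Nat.left_le_pair _ _)
    · exact (ht h).trans (Nat.right_le_pair _ _)
  | bd t ht => exact (ht h).trans (Nat.right_le_pair _ _)
  | _ => simp [STerm.atoms] at h

theorem SForm.code_le_of_mem_atoms (φ : SForm Atom) {x : Sigma Atom}
    (h : x ∈ φ.atoms) : Atom.code x.1 x.2 ≤ φ.code Atom.code := by
  induction φ with
  | falsum => simp [SForm.atoms] at h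
  | rel r s t =>
    refine le_trans ?_ ((Nat.right_le_pair _ _).trans
      ((Nat.right_le_pair _ _).trans (Nat.right_le_pair _ _)))
    rcases List.mem_append.1 h with h | h
    · exact (s.code_le_of_mem_atoms h).trans (Nat.left_le_pair _ _)
    · exact (t.code_le_of_mem_atoms h).trans (Nat.right_le_pair _ _)
  | neg φ hφ => exact (hφ h).trans (Nat.right_le_pair _ _)
  | and φ ψ hφ hψ =>
    refine le_trans ?_ (Nat.right_le_pair _ _)
    rcases List.mem_append.1 h with h | h
    · exact (hφ h).trans (Nat.left_le_pair _ _)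
    · exact (hψ h).trans (Nat.right_le_pair _ _)
  | all σ i φ hφ =>
    exact (hφ h).trans ((Nat.right_le_pair _ _).trans
      ((Nat.right_le_pair _ _).trans (Nat.right_le_pair _ _)))

theorem PEq.lhs_code_le (e : PEq) : e.lhs.code ≤ e.code :=
  (Nat.left_le_pair _ _).trans (Nat.right_le_pair _ _)

theorem PEq.rhs_code_le (e : PEq) : e.rhs.code ≤ e.code :=
  (Nat.right_le_pair _ _).trans (Nat.right_le_pair _ _)

theorem Clause.pos_code_le {c : Clause} {e : PEq} (h : e ∈ c.pos) : e.code ≤ c.code :=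
  (le_encode_of_mem (List.mem_map_of_mem h)).trans (Nat.left_le_pair _ _)

theorem Clause.neg_code_le {c : Clause} {e : PEq} (h : e ∈ c.neg) : e.code ≤ c.code :=
  (le_encode_of_mem (List.mem_map_of_mem h)).trans
    ((Nat.left_le_pair _ _).trans (Nat.right_le_pair _ _))

theorem Clause.atom_code_le {c : Clause} {x : Sigma Atom} (h : x ∈ c.body.atoms) :
    Atom.code x.1 x.2 ≤ c.code :=
  (c.body.code_le_of_mem_atoms h).trans ((Nat.right_le_pair _ _).trans (Nat.right_le_pair _ _))

/-- The code of a clause itself serves as the bound below which all relevant terms lie; no syntactic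
measure has to be computed. -/
theorem Clause.guardTerms_code_le {c : Clause} {u : Sigma PTerm} (h : u ∈ c.guardTerms) :
    u.2.code ≤ c.code := by
  simp only [Clause.guardTerms, List.mem_append, List.mem_flatMap] at h
  rcases h with (⟨e, he, h | h⟩ | ⟨e, he, h | h⟩) | ⟨a, ha, h⟩
  · exact (e.lhs.code_le_of_mem_subs (e.lhs.mem_subs_of_mem_proper h)).trans
      (e.lhs_code_le.trans (c.pos_code_le he))
  · exact (e.rhs.code_le_of_mem_subs (e.rhs.mem_subs_of_mem_proper h)).trans
      (e.rhs_code_le.trans (c.pos_code_le he))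
  · exact (e.lhs.code_le_of_mem_subs h).trans (e.lhs_code_le.trans (c.neg_code_le he))
  · exact (e.rhs.code_le_of_mem_subs h).trans (e.rhs_code_le.trans (c.neg_code_le he))
  · exact (a.2.code_le_of_mem_subs h).trans (c.atom_code_le ha)

/-! ### Restriction of structures -/

/-- An injection that commutes with the values of all terms of the clause preserves and reflects its
pointer equalities and leaves its atomic scalar terms unchanged. It serves both for restrictions
and, with the identity as injection, for two valuations that agree on the variables that occur. -/
theorem Clause.matrix_iff {S : ScalarStr} {M M' : Str S} {n : ℕ}
    (e : ∀ p, M'.carrier p → M.carrier p) (inj : ∀ p, Function.Injective (e p))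
    {w' : ∀ p, ℕ → M'.carrier p} {w : ∀ p, ℕ → M.carrier p}
    (hval : ∀ p (t : PTerm p), t.code ≤ n → e p (t.eval M' w') = t.eval M w)
    (hsc : ∀ σ i, M'.sconst σ i = M.sconst σ i) (hpc : ∀ b, M'.pc b = M.pc b)
    (hsf : ∀ p σ f d, M'.sfun p σ f d = M.sfun p σ f (e p d))
    (c : Clause) (hc : c.code ≤ n) (v : ∀ x : SSort × ℕ, S.carrier x.1) :
    c.Matrix M' w' v ↔ c.Matrix M w v := by
  have heq : ∀ q : PEq, q.code ≤ n → (q.Holds M' w' ↔ q.Holds M w) := by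
    intro q hq
    unfold PEq.Holds
    rw [← hval _ _ (q.lhs_code_le.trans hq), ← hval _ _ (q.rhs_code_le.trans hq)]
    exact (inj _).eq_iff.symm
  have hbody : c.body.Holds S (Atom.eval M' w') v ↔ c.body.Holds S (Atom.eval M w) v := by
    refine c.body.holds_congr (fun x hx => ?_) fun _ _ => rfl
    obtain ⟨σ, a⟩ := x
    have ha := (c.atom_code_le hx).trans hc
    cases a with
    | const σ i => exact hsc σ i
    | pc b => exact hpc b
    | field f t =>
      simp only [Atom.eval]
      rw [hsf, hval _ _ (((Nat.right_le_pair _ _).trans (Nat.right_le_pair _ _)).trans ha)]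
  unfold Clause.Matrix
  refine or_congr (exists_congr fun q => and_congr_right fun hq => ?_)
    (or_congr (exists_congr fun q => and_congr_right fun hq => ?_) hbody)
  · exact heq q ((c.pos_code_le hq).trans hc)
  · rw [heq q ((c.neg_code_le hq).trans hc)]

/-- `M'` is the restriction of `M` to a set of pointers: a function has the value `null` when its
value in `M` is not in the set. -/
structure Restriction (n : ℕ) {S : ScalarStr} (M' M : Str S) where
  emb : ∀ p, M'.carrier p → M.carrier p
  inj : ∀ p, Function.Injective (emb p)
  null : ∀ p, emb p (M'.null p) = M.null p
  pconst : ∀ p (c : PConst p), (PTerm.const c).code ≤ n → emb p (M'.pconst p c) = M.pconst p c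
  pfun : ∀ p q f d, emb q (M'.pfun p q f d) = M.pfun p q f (emb p d) ∨
    M.pfun p q f (emb p d) ∉ Set.range (emb q) ∧ M'.pfun p q f d = M'.null q
  sconst : ∀ σ i, M'.sconst σ i = M.sconst σ i
  pc : ∀ b, M'.pc b = M.pc b
  sfun : ∀ p σ f d, M'.sfun p σ f d = M.sfun p σ f (emb p d)

namespace Restriction

variable {n : ℕ} {S : ScalarStr} {M' M : Str S} (R : Restriction n M' M)

def primeIf (b : Bool) : Restriction n (M'.primeIf b) (M.primeIf b) where
  emb := R.emb
  inj := R.inj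
  null := R.null
  pconst := R.pconst
  pfun p q f d := R.pfun p q (f.primeIf b) d
  sconst := R.sconst
  pc x := R.pc (b || x)
  sfun p σ f d := R.sfun p σ (f.primeIf b) d

/-- Evaluation commutes with the embedding up to the innermost subterm whose value leaves the set;
that subterm is `null` in `M'`, which is what makes a guard true. -/
theorem eval_eq_or (w : ∀ p, ℕ → M'.carrier p) {p : PSort} (t : PTerm p) (ht : t.code ≤ n) :
    R.emb p (t.eval M' w) = t.eval M (fun p i => R.emb p (w p i)) ∨
      ∃ u ∈ t.subs, u.2.eval M' w = M'.null u.1 ∧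
        u.2.eval M (fun p i => R.emb p (w p i)) ∉ Set.range (R.emb u.1) := by
  induction t with
  | var p i => exact Or.inl rfl
  | const c => exact Or.inl (R.pconst _ c ht)
  | null p => exact Or.inl (R.null p)
  | app f t ih =>
    rcases ih (((Nat.right_le_pair _ _).trans (Nat.right_le_pair _ _)).trans ht) with h | ⟨u, hu, h⟩
    · rcases R.pfun _ _ f (t.eval M' w) with h' | h'
      · exact Or.inl (by rw [PTerm.eval, PTerm.eval, h', h])
      · refine Or.inr ⟨⟨_, .app f t⟩, PTerm.mem_subs_self _, h'.2, ?_⟩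
        have := h'.1
        rwa [h] at this
    · exact Or.inr ⟨u, List.mem_cons_of_mem _ hu, h⟩

/-- Version for the sides of positive equalities, where only proper subterms are guarded: the side
itself may leave the set and become `null`. -/
theorem eval_eq_or' (w : ∀ p, ℕ → M'.carrier p) {p : PSort} (t : PTerm p) (ht : t.code ≤ n) :
    (R.emb p (t.eval M' w) = t.eval M (fun p i => R.emb p (w p i)) ∨
      t.eval M (fun p i => R.emb p (w p i)) ∉ Set.range (R.emb p) ∧ t.eval M' w = M'.null p) ∨
      ∃ u ∈ t.proper, u.2.eval M' w = M'.null u.1 ∧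
        u.2.eval M (fun p i => R.emb p (w p i)) ∉ Set.range (R.emb u.1) := by
  cases t with
  | app f t =>
    rcases R.eval_eq_or w t (((Nat.right_le_pair _ _).trans (Nat.right_le_pair _ _)).trans ht)
      with h | h
    · left
      have := R.pfun _ _ f (t.eval M' w)
      rwa [h] at this
    · exact Or.inr h
  | var p i => exact Or.inl (Or.inl rfl)
  | const c => exact Or.inl (Or.inl (R.pconst _ c ht))
  | null p => exact Or.inl (Or.inl (R.null p))

/-- Clauses about non-null elements are preserved by restriction. -/
theorem holds {c : Clause} (hc : c.code ≤ n)
    (hg : ∀ u ∈ c.guardTerms, c.Guards u ∨ ∀ w, u.2.eval M w ∈ Set.range (R.emb u.1))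
    (h : c.Holds M) : c.Holds M' := by
  intro w v
  have bad : ∀ u ∈ c.guardTerms, u.2.eval M' w = M'.null u.1 →
      u.2.eval M (fun p i => R.emb p (w p i)) ∉ Set.range (R.emb u.1) →
        ∃ e ∈ c.pos, e.Holds M' w := by
    intro u hu h1 h2
    rcases hg u hu with (h | h) | h
    · exact ⟨_, h, h1⟩
    · exact ⟨_, h, h1.symm⟩
    · exact absurd (h _) h2
  by_cases hbad : ∃ e ∈ c.pos, e.Holds M' w
  · exact Or.inl hbad
  -- From here on no positive equality holds in `M'`, so in particular no guard does. Terms with all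
  -- subterms guarded therefore keep their values (`good`); if only proper subterms are guarded, the
  -- term may still become `null` (`semi`).
  have good : ∀ {p : PSort} (t : PTerm p), t.code ≤ n → (∀ u ∈ t.subs, u ∈ c.guardTerms) →
      R.emb p (t.eval M' w) = t.eval M (fun p i => R.emb p (w p i)) := by
    intro p t ht hsub
    rcases R.eval_eq_or w t ht with h | ⟨u, hu, h1, h2⟩
    · exact h
    · exact absurd (bad u (hsub u hu) h1 h2) hbad
  have semi : ∀ {p : PSort} (t : PTerm p), t.code ≤ n → (∀ u ∈ t.proper, u ∈ c.guardTerms) →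
      R.emb p (t.eval M' w) = t.eval M (fun p i => R.emb p (w p i)) ∨
      t.eval M (fun p i => R.emb p (w p i)) ∉ Set.range (R.emb p) ∧
        t.eval M' w = M'.null p := by
    intro p t ht hsub
    rcases R.eval_eq_or' w t ht with h | ⟨u, hu, h1, h2⟩
    · exact h
    · exact absurd (bad u (hsub u hu) h1 h2) hbad
  rcases h (fun p i => R.emb p (w p i)) v with ⟨e, he, h⟩ | ⟨e, he, h⟩ | h
  · refine Or.inl ⟨e, he, ?_⟩
    have hce := (c.pos_code_le he).trans hc
    have h1 := semi e.lhs (e.lhs_code_le.trans hce) fun u hu => by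
      simp only [Clause.guardTerms, List.mem_append, List.mem_flatMap]
      exact Or.inl (Or.inl ⟨e, he, Or.inl hu⟩)
    have h2 := semi e.rhs (e.rhs_code_le.trans hce) fun u hu => by
      simp only [Clause.guardTerms, List.mem_append, List.mem_flatMap]
      exact Or.inl (Or.inl ⟨e, he, Or.inr hu⟩)
    unfold PEq.Holds at h ⊢
    rw [h] at h1
    -- Both sides have the same value in `M`. Either it lies in the set and injectivity applies, or
    -- both sides are `null` in `M'`; the mixed cases are contradictory.
    rcases h1 with h1 | h1 <;> rcases h2 with h2 | h2
    · exact R.inj _ (h1.trans h2.symm)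
    · exact absurd ⟨_, h1⟩ h2.1
    · exact absurd ⟨_, h2⟩ h1.1
    · exact h1.2.trans h2.2.symm
  · refine Or.inr (Or.inl ⟨e, he, ?_⟩)
    have hce := (c.neg_code_le he).trans hc
    have h1 := good e.lhs (e.lhs_code_le.trans hce) fun u hu => by
      simp only [Clause.guardTerms, List.mem_append, List.mem_flatMap]
      exact Or.inl (Or.inr ⟨e, he, Or.inl hu⟩)
    have h2 := good e.rhs (e.rhs_code_le.trans hce) fun u hu => by
      simp only [Clause.guardTerms, List.mem_append, List.mem_flatMap]
      exact Or.inl (Or.inr ⟨e, he, Or.inr hu⟩)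
    unfold PEq.Holds at h ⊢
    intro h'
    rw [← h1, ← h2, h'] at h
    exact h rfl
  · refine Or.inr (Or.inr ((c.body.holds_congr (fun x hx => ?_) fun _ _ => rfl).2 h))
    obtain ⟨σ, a⟩ := x
    have ha := (c.atom_code_le hx).trans hc
    cases a with
    | const σ i => exact R.sconst σ i
    | pc b => exact R.pc b
    | field f t =>
      simp only [Atom.eval]
      rw [R.sfun, good t (((Nat.right_le_pair _ _).trans (Nat.right_le_pair _ _)).trans ha)
        fun u hu => ?_]
      simp only [Clause.guardTerms, List.mem_append, List.mem_flatMap]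
      exact Or.inr ⟨_, hx, hu⟩

/-- A failure of a clause is preserved if the values of its terms are. -/
theorem not_holds {c : Clause} (hc : c.code ≤ n) {w : ∀ p, ℕ → M.carrier p}
    {v : ∀ x : SSort × ℕ, S.carrier x.1}
    (hw : ∀ p (t : PTerm p), t.code ≤ n → t.eval M w ∈ Set.range (R.emb p))
    (h : ¬ c.Matrix M w v) : ¬ c.Holds M' := by
  classical
  -- Variables with codes at most `n` have their value in the range by `hw`; the others do not occur
  -- in `c` and may be `null`.
  let w' : ∀ p, ℕ → M'.carrier p := fun p i =>
    if h : w p i ∈ Set.range (R.emb p) then h.choose else M'.null p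
  have hval : ∀ p (t : PTerm p), t.code ≤ n → R.emb p (t.eval M' w') = t.eval M w := by
    intro p t ht
    induction t with
    | var p i =>
      have hm : w p i ∈ Set.range (R.emb p) := hw p _ ht
      simp only [PTerm.eval, w', dif_pos hm]
      exact hm.choose_spec
    | const c => exact R.pconst _ c ht
    | null p => exact R.null p
    | app f t ih =>
      have h1 := ih (((Nat.right_le_pair _ _).trans (Nat.right_le_pair _ _)).trans ht)
      have h2 := hw _ _ ht
      simp only [PTerm.eval] at h2 ⊢
      rw [← h1] at h2 ⊢
      rcases R.pfun _ _ f (t.eval M' w') with h3 | h3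
      · exact h3
      · exact absurd h2 h3.1
  intro hh
  exact h ((Clause.matrix_iff R.emb R.inj hval R.sconst R.pc R.sfun c hc v).1 (hh w' v))

end Restriction

/-! ### Tables -/

/-! ### Digits and injectivity of codes -/

theorem exists_digits {b : ℕ} (L : ℕ) (h : ℕ → ℕ) (hb : ∀ k, h k < b) :
    ∃ x < b ^ L, ∀ k < L, digit b x k = h k := by
  induction L generalizing h with
  | zero => exact ⟨0, by simp, by simp⟩
  | succ L ih =>
    obtain ⟨x, hx, hd⟩ := ih (fun k => h (k + 1)) fun k => hb _
    have b0 : 0 < b := (Nat.zero_le _).trans_lt (hb 0)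
    refine ⟨h 0 + b * x, ?_, fun k hk => ?_⟩
    · calc h 0 + b * x < b + b * x := Nat.add_lt_add_right (hb 0) _
        _ = b * (x + 1) := by ring
        _ ≤ b * b ^ L := Nat.mul_le_mul_left _ hx
        _ = b ^ (L + 1) := by ring
    · cases k with
      | zero => simp [digit, Nat.mod_eq_of_lt (hb 0)]
      | succ k =>
        rw [← hd k (Nat.lt_of_succ_lt_succ hk), digit, digit, pow_succ', ← Nat.div_div_eq_div_mul,
          Nat.add_mul_div_left _ _ b0, Nat.div_eq_of_lt (hb 0), zero_add]

theorem PSort.code_injective : Function.Injective PSort.code := by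
  intro p q h; cases p <;> cases q <;> simp_all [PSort.code]

theorem toNat_injective : ∀ {a b : Bool}, a.toNat = b.toNat → a = b := by decide

/-- The places in the table of a pointer structure. -/
inductive TableKey
  | const {p : PSort} (c : PConst p)
  | app {p q : PSort} (f : PSym p q) (i : ℕ)

def TableKey.code : TableKey → ℕ
  | .const c => Nat.pair 0 c.code
  | .app f i => Nat.pair 1 (Nat.pair f.code i)

/-- Different places of a table have different positions, so their entries can be prescribed
independently. -/
theorem TableKey.code_injective : Function.Injective TableKey.code := by
  intro x y h
  cases x with
  | const c =>
    cases y with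
    | const c' =>
      cases c <;> cases c' <;> simp_all [TableKey.code, PConst.code, Nat.pair_eq_pair]
      obtain rfl := PSort.code_injective h.1; simp
    | app f i => simp [TableKey.code, Nat.pair_eq_pair] at h
  | app f i =>
    cases y with
    | const c => simp [TableKey.code, Nat.pair_eq_pair] at h
    | app f' i' =>
      cases f <;> cases f' <;>
        simp_all [TableKey.code, PSym.code, Nat.pair_eq_pair] <;>
        (obtain ⟨h, -⟩ := h; exact toNat_injective h)

/-- The scalars of a structure. -/
inductive ScalarKey : SSort → Type
  | const (σ : SSort) (i : ℕ) : ScalarKey σ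
  | pc (b : Bool) : ScalarKey .int
  | field {p : PSort} {σ : SSort} (f : SSym p σ) (i : ℕ) : ScalarKey σ

def ScalarKey.code : {σ : SSort} → ScalarKey σ → ℕ
  | _, .const σ i => Nat.pair 0 (Nat.pair σ.code i)
  | _, .pc b => Nat.pair 1 b.toNat
  | _, .field f i => Nat.pair 2 (Nat.pair f.code i)

/-- Within each scalar sort, distinct scalar data of a structure get distinct constants, so any
values can be realised by one assignment of the constants. -/
theorem ScalarKey.code_injective (σ : SSort) :
    Function.Injective (ScalarKey.code (σ := σ)) := by
  intro x y h
  cases x with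
  | const σ i => cases y <;> simp_all [ScalarKey.code, Nat.pair_eq_pair]
  | pc b =>
    cases y with
    | pc b' =>
      simp only [ScalarKey.code, Nat.pair_eq_pair, true_and] at h
      rw [toNat_injective h]
    | _ => simp [ScalarKey.code, Nat.pair_eq_pair] at h
  | field f i =>
    cases y with
    | field f' i' =>
      cases f <;> cases f' <;>
        simp_all [ScalarKey.code, SSym.code, Nat.pair_eq_pair] <;>
        (obtain ⟨h, -⟩ := h; exact toNat_injective h)
    | _ => simp [ScalarKey.code, Nat.pair_eq_pair] at h

theorem PConst.code_injective (p : PSort) : Function.Injective (PConst.code (p := p)) := by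
  intro c c' h
  cases c <;> cases c' <;> simp_all [PConst.code, Nat.pair_eq_pair]

theorem PTerm.code_injective {p : PSort} : Function.Injective (PTerm.code (p := p)) := by
  intro t
  induction t with
  | var p i => intro u h; cases u <;> simp_all [PTerm.code, Nat.pair_eq_pair]
  | const c =>
    intro u h
    cases u with
    | const c' =>
      simp only [PTerm.code, Nat.pair_eq_pair, true_and] at h
      rw [PConst.code_injective _ h]
    | _ => simp [PTerm.code, Nat.pair_eq_pair] at h
  | null p => intro u h; cases u <;> simp_all [PTerm.code, Nat.pair_eq_pair]
  | app f t ih =>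
    intro u h
    cases u with
    | app f' t' =>
      simp only [PTerm.code, Nat.pair_eq_pair, true_and] at h
      have hk : TableKey.app f 0 = TableKey.app f' 0 :=
        TableKey.code_injective (by simp [TableKey.code, h.1])
      cases hk
      rw [ih h.2]
    | _ => simp [PTerm.code, Nat.pair_eq_pair] at h

/-! ### Size of the restricted structures -/

theorem PSym.code_le {p q : PSort} (f : PSym p q) : f.code ≤ 43 := by
  -- The largest code of a pointer function is `Nat.pair 6 1 = 43`, that of primed `incoming`.
  have : ∀ k b : ℕ, k ≤ 6 → b ≤ 1 → Nat.pair k b ≤ 43 := fun k b hk hb =>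
    (pair_le_pair hk hb).trans (by decide)
  cases f <;> exact this _ _ (by norm_num) (by first | exact Bool.toNat_le _ | norm_num)

/-- A bound for the number of non-null elements of a sort. -/
def sizeBound (n : ℕ) : ℕ := 2 * n + 2

/-- A bound for the places in the table of a structure. -/
def tableBound (n : ℕ) : ℕ := Nat.pair 1 (Nat.pair 43 (sizeBound n)) + 1

/-- A bound for the numbers of the structures. -/
def structureBound (n : ℕ) : ℕ :=
  Nat.pair (sizeBound n) (Nat.pair (sizeBound n)
    ((sizeBound n + sizeBound n + 1) ^ tableBound n)) + 1

/-- The distinguished element `a`, which will be `null`, receives the number 0, as `tableStr`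
requires. -/
theorem exists_enumeration {α : Type} (C : Finset α) (a : α) (ha : a ∈ C) :
    ∃ m, m + 1 = C.card ∧ ∃ e : ℕ → α, e 0 = a ∧ (∀ i ≤ m, ∀ j ≤ m, e i = e j → i = j) ∧
      ∀ x ∈ C, ∃ i ≤ m, e i = x := by
  classical
  let L := (C.erase a).toList
  have hL : L.length + 1 = C.card := by
    rw [Finset.length_toList, Finset.card_erase_add_one ha]
  have hnd : (a :: L).Nodup := by
    refine List.nodup_cons.2 ⟨?_, Finset.nodup_toList _⟩
    simp [L]
  refine ⟨L.length, hL, fun i => (a :: L).getD i a, rfl, fun i hi j hj h => ?_, fun x hx => ?_⟩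
  · have hi' : i < (a :: L).length := Nat.lt_succ_of_le hi
    have hj' : j < (a :: L).length := Nat.lt_succ_of_le hj
    simp only [List.getD_eq_getElem _ _ hi', List.getD_eq_getElem _ _ hj'] at h
    exact (hnd.getElem_inj_iff).1 h
  · have hx' : x ∈ a :: L := by
      by_cases h : x = a
      · simp [h]
      · simp [L, h, hx]
    obtain ⟨i, hi, rfl⟩ := List.mem_iff_getElem.1 hx'
    exact ⟨i, Nat.le_of_lt_succ hi, List.getD_eq_getElem _ _ hi⟩

/-- Finitely many elements of a structure are contained in a small restriction. -/
theorem exists_restriction_of_enumeration {S : ScalarStr} (M : Str S) (n : ℕ) (m : PSort → ℕ)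
    (hm : ∀ p, m p ≤ sizeBound n) (e : ∀ p, ℕ → M.carrier p) (h0 : ∀ p, e p 0 = M.null p)
    (hinj : ∀ p, ∀ i ≤ m p, ∀ j ≤ m p, e p i = e p j → i = j)
    (hconst : ∀ p (c : PConst p), (PTerm.const c).code ≤ n → ∃ i ≤ m p, e p i = M.pconst p c) :
    ∃ z < structureBound n, ∃ k : ∀ σ, ℕ → S.carrier σ, ∃ R : Restriction n (tableStr S z k) M,
      ∀ p a, (∃ i ≤ m p, e p i = a) → a ∈ Set.range (R.emb p) := by
  classical
  -- The number of an element in the enumeration. The default 0 is the number of `null`, so that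
  -- values outside the set are sent to `null`.
  let ret : ∀ p, M.carrier p → ℕ := fun p a => if h : ∃ i ≤ m p, e p i = a then h.choose else 0
  have ret_le : ∀ p a, ret p a ≤ m p := by
    intro p a
    by_cases h : ∃ i ≤ m p, e p i = a
    · simp only [ret, dif_pos h]; exact h.choose_spec.1
    · simp [ret, dif_neg h]
  have ret_eq : ∀ p a, (∃ i ≤ m p, e p i = a) → e p (ret p a) = a := by
    intro p a h
    simp only [ret, dif_pos h]; exact h.choose_spec.2
  have ret_zero : ∀ p a, (¬ ∃ i ≤ m p, e p i = a) → ret p a = 0 := by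
    intro p a h
    simp only [ret, dif_neg h]
  let val : TableKey → ℕ := fun x => match x with
    | .const (p := p) c => ret p (M.pconst p c)
    | .app (p := p) (q := q) f i => ret q (M.pfun p q f (e p i))
  let B := m .train + m .seg + 1
  have hB : ∀ p i, i ≤ m p → i < B := by
    intro p i hi; cases p <;> simp only [B] <;> omega
  -- One number `x` stores all constants and function values as digits to the base `B`, which
  -- exceeds every element number of both sorts. Positions that are not codes of places get 0.
  obtain ⟨x, hx, hdig⟩ := exists_digits (b := B) (tableBound n)
    (Function.extend TableKey.code val fun _ => 0) (by
      intro k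
      by_cases hk : ∃ x, TableKey.code x = k
      · obtain ⟨y, rfl⟩ := hk
        rw [TableKey.code_injective.extend_apply]
        cases y <;> exact hB _ _ (ret_le _ _)
      · rw [Function.extend_apply' _ _ _ hk]; exact Nat.succ_pos _)
  let z := Nat.pair (m .train) (Nat.pair (m .seg) x)
  have hsize : ∀ p, size z p = m p := by intro p; cases p <;> simp [size, z]
  have hbase : base z = B := by simp [base, z, B]
  have hentry : ∀ y : TableKey, y.code < tableBound n → entry z y.code = val y := by
    intro y hy
    rw [entry, hbase]
    simp only [z, codeSnd_pair]
    rw [hdig _ hy, TableKey.code_injective.extend_apply]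
  have hz : z < structureBound n := by
    refine Nat.lt_succ_of_le (pair_le_pair (hm _) (pair_le_pair (hm _) (hx.le.trans ?_)))
    refine Nat.pow_le_pow_left ?_ _
    have := hm .train
    have := hm .seg
    simp only [B]; omega
  let key : ∀ {σ}, ScalarKey σ → S.carrier σ := fun x => match x with
    | .const σ i => M.sconst σ i
    | .pc b => M.pc b
    | .field (p := p) (σ := σ) f i => M.sfun p σ f (e p i)
  let k : ∀ σ, ℕ → S.carrier σ := fun σ =>
    Function.extend (ScalarKey.code (σ := σ)) key fun _ => S.zero σ
  have hk : ∀ {σ} (x : ScalarKey σ), k σ x.code = key x := fun x =>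
    (ScalarKey.code_injective _).extend_apply _ _ _
  refine ⟨z, hz, k, ?_⟩
  have hfun : ∀ p q (f : PSym p q) (d : Fin (size z p + 1)),
      ((tableStr S z k).pfun p q f d : Fin (size z q + 1)).val =
        ret q (M.pfun p q f (e p d.val)) := by
    intro p q f d
    have hd : d.val ≤ sizeBound n :=
      (Nat.le_of_lt_succ d.2).trans ((hsize p).le.trans (hm p))
    have := hentry (.app f d.val)
      (Nat.lt_succ_of_le (pair_le_pair le_rfl (pair_le_pair f.code_le hd)))
    have hlt : ret q (M.pfun p q f (e p d.val)) < size z q + 1 :=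
      Nat.lt_succ_of_le ((ret_le _ _).trans (hsize q).ge)
    simp only [TableKey.code, val] at this
    simp [tableStr, this, Nat.mod_eq_of_lt hlt]
  have hcon : ∀ p (c : PConst p), (PTerm.const c).code ≤ n →
      ((tableStr S z k).pconst p c : Fin (size z p + 1)).val = ret p (M.pconst p c) := by
    intro p c hc
    have hc' : c.code ≤ Nat.pair 43 (sizeBound n) :=
      (Nat.right_le_pair _ _).trans <| hc.trans ((by unfold sizeBound; omega : n ≤ sizeBound n).trans (Nat.right_le_pair _ _))
    have := hentry (.const c) (Nat.lt_succ_of_le (pair_le_pair (Nat.zero_le _) hc'))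
    have hlt : ret p (M.pconst p c) < size z p + 1 :=
      Nat.lt_succ_of_le ((ret_le _ _).trans (hsize p).ge)
    simp only [TableKey.code, val] at this
    simp [tableStr, this, Nat.mod_eq_of_lt hlt]
  have hrange : ∀ q a, a ∈ Set.range (fun d : Fin (size z q + 1) => e q d.val) →
      ∃ i ≤ m q, e q i = a := by
    rintro q _ ⟨d, rfl⟩
    exact ⟨d.val, (Nat.le_of_lt_succ d.2).trans (hsize q).le, rfl⟩
  refine ⟨{
    emb := fun p (d : Fin (size z p + 1)) => e p d.val
    inj := ?_
    null := ?_
    pconst := ?_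
    pfun := ?_
    sconst := ?_
    pc := ?_
    sfun := ?_ }, ?_⟩
  · intro p d d' h
    exact Fin.ext (hinj p _ ((Nat.le_of_lt_succ d.2).trans (hsize p).le) _
      ((Nat.le_of_lt_succ d'.2).trans (hsize p).le) h)
  · exact fun p => h0 p
  · intro p c hc
    rw [hcon p c hc]
    exact ret_eq _ _ (hconst p c hc)
  · intro p q f (d : Fin (size z p + 1))
    by_cases h : ∃ i ≤ m q, e q i = M.pfun p q f (e p d.val)
    · left
      rw [hfun]
      exact ret_eq _ _ h
    · right
      refine ⟨fun h' => h (hrange _ _ h'), Fin.ext ?_⟩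
      refine (hfun p q f d).trans ?_
      rw [ret_zero _ _ h]
      rfl
  · exact fun σ i => hk (.const σ i)
  · exact fun b => hk (.pc b)
  · exact fun p σ f d => hk (.field f (Fin.val d))
  · rintro p a ⟨i, hi, rfl⟩
    exact ⟨(⟨i, Nat.lt_succ_of_le (hi.trans (hsize p).ge)⟩ : Fin (size z p + 1)), rfl⟩

/-- The set consists of `null` and the values at `w` of all terms with code at most `n`, under both
readings of the symbols. That is at most `1 + 2 * (n + 1)` elements per sort, i.e. at most
`sizeBound n` besides `null`. The unprimed reading retains the ground terms of the assumptions, the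
primed one the terms of a primed goal. -/
theorem exists_restriction {S : ScalarStr} (M : Str S) (n : ℕ) (w : ∀ p, ℕ → M.carrier p) :
    ∃ z < structureBound n, ∃ k : ∀ σ, ℕ → S.carrier σ, ∃ R : Restriction n (tableStr S z k) M,
      ∀ b p (t : PTerm p), t.code ≤ n → t.eval (M.primeIf b) w ∈ Set.range (R.emb p) := by
  classical
  have : ∀ p, Nonempty (PTerm p) := fun p => ⟨.null p⟩
  -- Terms are recovered from their codes; numbers that are not codes contribute some further value,
  -- which does no harm.
  let value : ∀ p, Bool × ℕ → M.carrier p := fun p x =>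
    (Function.invFun (PTerm.code (p := p)) x.2).eval (M.primeIf x.1) w
  let C : ∀ p, Finset (M.carrier p) := fun p =>
    insert (M.null p) ((Finset.univ ×ˢ Finset.range (n + 1)).image (value p))
  have hC : ∀ p, (C p).card ≤ 2 * n + 3 := by
    intro p
    refine (Finset.card_insert_le _ _).trans (Nat.succ_le_succ (Finset.card_image_le.trans ?_))
    rw [Finset.card_product, Finset.card_range, Finset.card_univ, Fintype.card_bool]
    omega
  have hval : ∀ b p (t : PTerm p), t.code ≤ n → t.eval (M.primeIf b) w ∈ C p := by
    intro b p t ht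
    refine Finset.mem_insert_of_mem (Finset.mem_image.2 ⟨(b, t.code), ?_, ?_⟩)
    · simpa using Nat.lt_succ_of_le ht
    · simp only [value, Function.leftInverse_invFun PTerm.code_injective t]
  choose m hm e he0 hinj hsurj using fun p =>
    exists_enumeration (C p) (M.null p) (Finset.mem_insert_self _ _)
  obtain ⟨z, hz, k, R, hR⟩ := exists_restriction_of_enumeration M n m
    (fun p => by have := hm p; have := hC p; unfold sizeBound; omega) e he0 hinj
    fun p c hc => hsurj p _ (hval false p (.const c) hc)
  exact ⟨z, hz, k, R, fun b p t ht => hR p _ (hsurj p _ (hval b p t ht))⟩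

/-! ### The decision procedure -/

/-- All instances of the clauses `Φ` in the structure `z`, for valuations up to `n`. -/
def allInst (z n : ℕ) (b : Bool) (Φ : List Clause) : ScalarFormula :=
  Φ.foldr (fun c φ => .and (.conjBelow (fun y => inst (z, y, b) c) (base z ^ (n + 1))) φ) .top

def allInstCode (z n : ℕ) (b : Bool) (Φ : ℕ) : ℕ :=
  (listOf Φ).foldr (fun c u => Nat.pair 3 (Nat.pair
    (conjBelowCode (fun y => instCode (z, y, b) c) (base z ^ (n + 1))) u))
    (Nat.pair 2 (Nat.pair 0 0))

/-- Satisfiable if and only if `A` has a model in which `G`, primed if `b` holds, fails. -/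
def counterexample (n : ℕ) (b : Bool) (A G : List Clause) : ScalarFormula :=
  .neg (.conjBelow (fun z => .neg (.and (allInst z n false A) (.neg (allInst z n b G))))
    (structureBound n))

def counterexampleCode (b : Bool) (n : ℕ) : ℕ :=
  Nat.pair 2 (conjBelowCode (fun z => Nat.pair 2 (Nat.pair 3 (Nat.pair
    (allInstCode z n false n.codeFst) (Nat.pair 2 (allInstCode z n b n.codeSnd)))))
    (structureBound n))

theorem code_allInst (z n : ℕ) (b : Bool) (Φ : List Clause) :
    ScalarFormula.code (allInst z n b Φ) = allInstCode z n b (codeClauses Φ) := by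
  simp only [allInstCode, codeClauses, listOf_encode, List.foldr_map, allInst]
  induction Φ with
  | nil => rfl
  | cons c Φ ih =>
    rw [List.foldr_cons, List.foldr_cons, ← ih]
    simp only [← code_inst, ScalarFormula.code, SForm.code, SForm.code_conjBelow]

theorem code_counterexample (b : Bool) (A G : List Clause) :
    ScalarFormula.code (counterexample (Nat.pair (codeClauses A) (codeClauses G)) b A G) =
      counterexampleCode b (Nat.pair (codeClauses A) (codeClauses G)) := by
  simp only [counterexampleCode, codeFst_pair, codeSnd_pair, ← code_allInst]
  simp only [counterexample, ScalarFormula.code, SForm.code, SForm.code_conjBelow]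

theorem primrec_allInstCode (b : Bool) {α : Type} [Primcodable α] {f g h : α → ℕ}
    (hf : Primrec f) (hg : Primrec g) (hh : Primrec h) :
    Primrec fun a => allInstCode (f a) (g a) b (h a) := by
  refine primrec_foldr_listOf (g := fun a c u => Nat.pair 3 (Nat.pair
    (conjBelowCode (fun y => instCode (f a, y, b) c) (base (f a) ^ (g a + 1))) u)) ?_ hh
    (Primrec.const _)
  have h1 : Primrec fun q : (α × ℕ × ℕ) × ℕ => instCode (f q.1.1, q.2, b) q.1.2.1 := by fun_prop
  have h2 : Primrec fun p : α × ℕ × ℕ => base (f p.1) ^ (g p.1 + 1) := by fun_prop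
  have h3 := primrec_conjBelowCode
    (g := fun (p : α × ℕ × ℕ) y => instCode (f p.1, y, b) p.2.1) h1 h2
  fun_prop

theorem primrec_structureBound : Primrec structureBound := by
  unfold structureBound tableBound sizeBound
  fun_prop

theorem primrec_counterexampleCode (b : Bool) : Primrec (counterexampleCode b) := by
  have h1 : Primrec fun p : ℕ × ℕ => allInstCode p.2 p.1 false p.1.codeFst :=
    primrec_allInstCode _ (by fun_prop) (by fun_prop) (by fun_prop)
  have h2 : Primrec fun p : ℕ × ℕ => allInstCode p.2 p.1 b p.1.codeSnd :=
    primrec_allInstCode _ (by fun_prop) (by fun_prop) (by fun_prop)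
  have h3 : Primrec fun p : ℕ × ℕ => Nat.pair 2 (Nat.pair 3 (Nat.pair
    (allInstCode p.2 p.1 false p.1.codeFst) (Nat.pair 2 (allInstCode p.2 p.1 b p.1.codeSnd)))) :=
    by fun_prop
  exact primrec_pair (Primrec.const 2) (primrec_conjBelowCode
    (g := fun n z => Nat.pair 2 (Nat.pair 3 (Nat.pair
    (allInstCode z n false n.codeFst) (Nat.pair 2 (allInstCode z n b n.codeSnd))))) h3
    primrec_structureBound)

/-! ### Correctness of the search for a counterexample -/

/-- The value of the variable `i` of sort `p` is the digit at position `Nat.pair p.code i`, so `n +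
1` digits cover all variables that can occur in a clause with code at most `n`. -/
theorem exists_valuation (z n : ℕ) (w : ∀ p, ℕ → Fin (size z p + 1)) :
    ∃ y < base z ^ (n + 1), ∀ p i, Nat.pair p.code i ≤ n → valuation z y p i = w p i := by
  have hb : ∀ p (d : Fin (size z p + 1)), d.val < base z := by
    intro p d
    have := d.2
    cases p <;> simp only [size, base] at this ⊢ <;> omega
  obtain ⟨y, hy, h⟩ := exists_digits (b := base z) (n + 1)
    (fun k => if k.codeFst = 0 then (w .train k.codeSnd).val else (w .seg k.codeSnd).val)
    (fun k => by split_ifs <;> exact hb _ _)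
  refine ⟨y, hy, fun p i hi => Fin.ext ?_⟩
  have hd := h _ (Nat.lt_succ_of_le hi)
  cases p <;> simp [PSort.code] at hd <;>
    simp [valuation, PSort.code, hd]

/-- Finitely many valuations suffice because only the variables with small codes matter, and the
scalar valuation `v` is irrelevant because the scalar parts are closed. -/
theorem holds_allInst {S : ScalarStr} {k : ∀ σ, ℕ → S.carrier σ}
    {v : ∀ x : SSort × ℕ, S.carrier x.1} {z n : ℕ} {b : Bool} {Φ : List Clause}
    (hΦ : ∀ c ∈ Φ, c.code ≤ n ∧ c.body.Closed) :
    SForm.Holds S k v (allInst z n b Φ) ↔ HoldsAll ((tableStr S z k).primeIf b) Φ := by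
  have h1 : SForm.Holds S k v (allInst z n b Φ) ↔
      ∀ c ∈ Φ, ∀ y < base z ^ (n + 1), SForm.Holds S k v (inst (z, y, b) c) := by
    clear hΦ
    induction Φ with
    | nil => simp [allInst, SForm.holds_top]
    | cons c Φ ih =>
      rw [List.forall_mem_cons, ← ih, ← SForm.holds_conjBelow]
      rfl
  rw [h1]
  refine forall₂_congr fun c hc => ?_
  obtain ⟨hn, hcl⟩ := hΦ c hc
  constructor
  · intro h w v'
    obtain ⟨y, hy, hyw⟩ := exists_valuation z n w
    have hm := (holds_inst S z y b k v c).1 (h y hy)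
    have hm' := (Clause.matrix_iff (M := (tableStr S z k).primeIf b)
      (M' := (tableStr S z k).primeIf b) (fun _ => id)
      (fun _ => Function.injective_id) (w' := valuation z y) (w := w) (fun p t ht => ?_)
      (fun _ _ => rfl) (fun _ => rfl) (fun _ _ _ _ => rfl) c hn v).1 hm
    · exact hm'.imp_right (Or.imp_right (hcl.holds_iff _ v v').1)
    · induction t with
      | var p i => exact hyw p i ((Nat.right_le_pair _ _).trans ht)
      | const c => rfl
      | null p => rfl
      | app f t ih =>
        have := ih (((Nat.right_le_pair _ _).trans (Nat.right_le_pair _ _)).trans ht)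
        simp only [id, PTerm.eval] at this ⊢
        rw [this]
  · exact fun h y _ => (holds_inst S z y b k v c).2 (h _ v)

theorem Str.primeIf_false {S : ScalarStr} (M : Str S) : M.primeIf false = M := rfl

theorem PTerm.IsGround.eval_eq {S : ScalarStr} {M : Str S} {p : PSort} {t : PTerm p}
    (h : t.IsGround) (w w' : ∀ p, ℕ → M.carrier p) : t.eval M w = t.eval M w' := by
  induction t with
  | var p i => exact h.elim
  | app f t ih => simp only [PTerm.eval]; rw [ih h]
  | _ => rfl

/-- A solution of the formula is itself a counterexample, namely a table structure. Conversely, an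
arbitrary counterexample is restricted to the values of terms at the valuation where the goal fails.
Only this direction uses that the assumptions are rules. -/
theorem satisfiable_counterexample {K : Set ScalarStr} {n : ℕ} {b : Bool} {A G : List Clause}
    (hA : ∀ c ∈ A, c.code ≤ n ∧ c.IsRule) (hG : ∀ c ∈ G, c.code ≤ n ∧ c.body.Closed) :
    ScalarFormula.Satisfiable K (counterexample n b A G) ↔
      ¬ ∀ S ∈ K, ∀ M : Str S, HoldsAll M A → HoldsAll (M.primeIf b) G := by
  have hA' : ∀ c ∈ A, c.code ≤ n ∧ c.body.Closed := fun c hc => ⟨(hA c hc).1, (hA c hc).2.1⟩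
  constructor
  · rintro ⟨S, hS, k, v, h⟩ hall
    refine h ((SForm.holds_conjBelow _ _ _ _).2 fun z _ hz => ?_)
    have hzA := (holds_allInst hA').1 hz.1
    rw [Str.primeIf_false] at hzA
    exact hz.2 ((holds_allInst hG).2 (hall S hS (tableStr S z k) hzA))
  · intro h
    push Not at h
    obtain ⟨S, hS, M, hMA, hMG⟩ := h
    simp only [HoldsAll, Clause.Holds, not_forall] at hMG
    obtain ⟨c, hc, w, v, hcv⟩ := hMG
    obtain ⟨z, hz, k, R, hR⟩ := exists_restriction M n w
    refine ⟨S, hS, k, v, fun hall => ?_⟩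
    refine (SForm.holds_conjBelow _ _ _ _).1 hall z hz ⟨(holds_allInst hA').2 ?_, fun hg => ?_⟩
    · rw [Str.primeIf_false]
      intro a ha
      refine R.holds (hA a ha).1 (fun u hu => ?_) (hMA a ha)
      rcases (hA a ha).2.2 u hu with hu' | hu'
      -- A ground term has the same value under all valuations, and its value under `w` was kept.
      · refine Or.inr fun w' => ?_
        rw [hu'.eval_eq w' w]
        exact hR false u.1 u.2 ((Clause.guardTerms_code_le hu).trans (hA a ha).1)
      · exact Or.inl hu'
    · exact (R.primeIf b).not_holds (hG c hc).1 (hR b) hcv ((holds_allInst hG).1 hg c hc)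

/-! ### Fragments -/

section Fragment

variable {K : Set ScalarStr} {F : Set ScalarFormula}

theorem IsDecidableFragment.conjBelow_mem (hF : IsDecidableFragment K F)
    (hfalse : SForm.falsum ∈ F) {g : ℕ → ScalarFormula} (hg : ∀ i, g i ∈ F) (n : ℕ) :
    SForm.conjBelow g n ∈ F := by
  induction n with
  | zero => exact hF.neg _ hfalse
  | succ n ih => exact hF.and _ ih _ (hg n)

theorem IsDecidableFragment.inst_mem (hF : IsDecidableFragment K F)
    (hfalse : SForm.falsum ∈ F) {c : Clause} (hc : InFragment F c.body) (a : Env) :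
    inst a c ∈ F := by
  have htop := hF.neg _ hfalse
  unfold inst
  induction c.pos with
  | nil =>
    induction c.neg with
    | nil => exact hc _
    | cons e L ih =>
      rw [List.foldr_cons]
      split_ifs
      · exact ih
      · exact htop
  | cons e L ih =>
    rw [List.foldr_cons]
    split_ifs
    · exact htop
    · exact ih

theorem IsDecidableFragment.allInst_mem (hF : IsDecidableFragment K F)
    (hfalse : SForm.falsum ∈ F) {Φ : List Clause}
    (hΦ : ∀ c ∈ Φ, InFragment F c.body) (z n : ℕ) (b : Bool) : allInst z n b Φ ∈ F := by
  induction Φ with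
  | nil => exact hF.neg _ hfalse
  | cons c Φ ih =>
    rw [List.forall_mem_cons] at hΦ
    exact hF.and _ (hF.conjBelow_mem hfalse (fun y => hF.inst_mem hfalse hΦ.1 _) _) _ (ih hΦ.2)

theorem IsDecidableFragment.counterexample_mem (hF : IsDecidableFragment K F)
    (hfalse : SForm.falsum ∈ F) {A G : List Clause}
    (hA : ∀ c ∈ A, InFragment F c.body) (hG : ∀ c ∈ G, InFragment F c.body) (n : ℕ) (b : Bool) :
    counterexample n b A G ∈ F :=
  hF.neg _ (hF.conjBelow_mem hfalse (fun _ => hF.neg _ (hF.and _ (hF.allInst_mem hfalse hA _ _ _) _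
    (hF.neg _ (hF.allInst_mem hfalse hG _ _ _)))) _)

/-- Entailment between update rules is decidable. -/
theorem IsDecidableFragment.decides_entailment (hF : IsDecidableFragment K F)
    (hfalse : SForm.falsum ∈ F) (b : Bool) :
    Decides (fun x : List Clause × List Clause => Nat.pair (codeClauses x.1) (codeClauses x.2))
      (fun x => (∀ c ∈ x.1, c.IsRule ∧ InFragment F c.body) ∧
        ∀ c ∈ x.2, c.body.Closed ∧ InFragment F c.body)
      (fun x => ∀ S ∈ K, ∀ M : Str S, HoldsAll M x.1 → HoldsAll (M.primeIf b) x.2) := by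
  obtain ⟨f, hf, hdec⟩ := hF.decidable
  refine ⟨fun n => !f (counterexampleCode b n),
    Primrec.not.to_comp.comp (hf.comp (primrec_counterexampleCode b).to_comp), ?_⟩
  rintro ⟨A, G⟩ ⟨hA, hG⟩
  -- The pair of the codes of `A` and `G` is both the input of the procedure and the bound `n` on
  -- the codes of clauses.
  have hmem := hF.counterexample_mem hfalse (fun c hc => (hA c hc).2) (fun c hc => (hG c hc).2)
    (Nat.pair (codeClauses A) (codeClauses G)) b
  have hle : ∀ {Φ : List Clause} {c : Clause}, c ∈ Φ → c.code ≤ codeClauses Φ :=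
    fun hc => le_encode_of_mem (List.mem_map_of_mem hc)
  have h := hdec _ hmem
  rw [code_counterexample, satisfiable_counterexample
    (fun c hc => ⟨(hle hc).trans (Nat.left_le_pair _ _), (hA c hc).1⟩)
    (fun c hc => ⟨(hle hc).trans (Nat.right_le_pair _ _), (hG c hc).1⟩)] at h
  rw [Bool.not_eq_true', ← Bool.not_eq_true, h, not_not]

end Fragment

/-! ### Priming -/

/-- Priming a term amounts to reading it in the reduct `M.primeIf true`. The invariant can thus be
tested after a transition without computing the primed clauses. -/
theorem PTerm.eval_prime {S : ScalarStr} (M : Str S) (w : ∀ p, ℕ → M.carrier p) {p : PSort}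
    (t : PTerm p) : t.prime.eval M w = t.eval (M.primeIf true) w := by
  induction t with
  | app f t ih => simp only [PTerm.prime, PTerm.eval, ih]; rfl
  | _ => rfl

theorem Atom.eval_prime {S : ScalarStr} (M : Str S) (w : ∀ p, ℕ → M.carrier p) {σ : SSort}
    (a : Atom σ) : (Atom.prime σ a).eval M w = a.eval (M.primeIf true) w := by
  cases a with
  | field f t => simp only [Atom.prime, Atom.eval, PTerm.eval_prime]; rfl
  | _ => rfl

theorem PEq.holds_prime {S : ScalarStr} (M : Str S) (w : ∀ p, ℕ → M.carrier p) (e : PEq) :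
    e.prime.Holds M w ↔ e.Holds (M.primeIf true) w := by
  simp only [PEq.Holds, PEq.prime, PTerm.eval_prime]
  rfl

theorem Clause.holds_prime {S : ScalarStr} (M : Str S) (c : Clause) :
    c.prime.Holds M ↔ c.Holds (M.primeIf true) := by
  refine forall_congr' fun w => forall_congr' fun v => ?_
  refine or_congr ?_ (or_congr ?_ ?_)
  · simp only [Clause.prime, List.mem_map, exists_exists_and_eq_and, PEq.holds_prime]
  · simp only [Clause.prime, List.mem_map, exists_exists_and_eq_and, PEq.holds_prime]
  · simp only [Clause.prime, SForm.holds_map, Atom.eval_prime]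

theorem holdsAll_prime {S : ScalarStr} (M : Str S) (Φ : List Clause) :
    HoldsAll M (Φ.map Clause.prime) ↔ HoldsAll (M.primeIf true) Φ := by
  simp only [HoldsAll, List.forall_mem_map, Clause.holds_prime]

theorem STerm.vars_map {A B : SSort → Type} (θ : ∀ σ, A σ → B σ) {σ : SSort} (t : STerm A σ) :
    (t.map θ).vars = t.vars := by
  induction t <;> simp_all [STerm.map, STerm.vars]

theorem SForm.free_map {A B : SSort → Type} (θ : ∀ σ, A σ → B σ) (φ : SForm A) :
    (φ.map θ).free = φ.free := by
  induction φ <;> simp_all [SForm.map, SForm.free, STerm.vars_map]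

theorem STerm.atoms_map {A B : SSort → Type} (θ : ∀ σ, A σ → B σ) {σ : SSort} (t : STerm A σ) :
    (t.map θ).atoms = t.atoms.map fun x => ⟨x.1, θ x.1 x.2⟩ := by
  induction t <;> simp_all [STerm.map, STerm.atoms]

theorem SForm.atoms_map {A B : SSort → Type} (θ : ∀ σ, A σ → B σ) (φ : SForm A) :
    (φ.map θ).atoms = φ.atoms.map fun x => ⟨x.1, θ x.1 x.2⟩ := by
  induction φ <;> simp_all [SForm.map, SForm.atoms, STerm.atoms_map]

def primeSigma (u : Sigma PTerm) : Sigma PTerm := ⟨u.1, u.2.prime⟩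

theorem PTerm.subs_prime {p : PSort} (t : PTerm p) : t.prime.subs = t.subs.map primeSigma := by
  induction t with
  | app f t ih => simp only [PTerm.prime, PTerm.subs, ih, List.map_cons]; rfl
  | _ => rfl

theorem PTerm.proper_prime {p : PSort} (t : PTerm p) :
    t.prime.proper = t.proper.map primeSigma := by
  cases t with
  | app f t => exact t.subs_prime
  | _ => rfl

theorem Atom.subs_prime {σ : SSort} (a : Atom σ) :
    (Atom.prime σ a).subs = a.subs.map primeSigma := by
  cases a with
  | field f t => exact t.subs_prime
  | _ => rfl

theorem Clause.guardTerms_prime (c : Clause) :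
    c.prime.guardTerms = c.guardTerms.map primeSigma := by
  simp only [Clause.guardTerms, Clause.prime, List.map_append, List.map_flatMap, List.flatMap_map,
    SForm.atoms_map, PEq.prime, PTerm.subs_prime, PTerm.proper_prime, Atom.subs_prime]

theorem PTerm.IsGround.prime {p : PSort} {t : PTerm p} (h : t.IsGround) : t.prime.IsGround := by
  induction t with
  | app f t ih => exact ih h
  | _ => exact h

theorem Clause.IsRule.prime {c : Clause} (h : c.IsRule) : c.prime.IsRule := by
  refine ⟨(SForm.free_map _ _).trans h.1, fun u hu => ?_⟩
  rw [Clause.guardTerms_prime] at hu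
  obtain ⟨u', hu', rfl⟩ := List.mem_map.1 hu
  refine (h.2 u' hu').imp PTerm.IsGround.prime (Or.imp (fun h => ?_) fun h => ?_)
  · exact List.mem_map_of_mem (f := PEq.prime) h
  · exact List.mem_map_of_mem (f := PEq.prime) h

/-! ### The clauses of the system are update rules -/

theorem Clause.IsExtended.isRule {c : Clause} (h : c.IsExtended) : c.IsRule :=
  ⟨h.2.1, fun u hu => Or.inr (h.2.2 u hu)⟩

theorem PTerm.mem_subs_trans {p : PSort} (t : PTerm p) {u v : Sigma PTerm} (hu : u ∈ t.subs)
    (hv : v ∈ u.2.subs) : v ∈ t.subs := by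
  induction t with
  | app f t ih =>
    rcases List.mem_cons.1 hu with rfl | hu
    · exact hv
    · exact List.mem_cons_of_mem _ (ih hu)
  | _ => obtain rfl := List.mem_singleton.1 hu; exact hv

theorem PTerm.mem_proper_trans {p : PSort} (t : PTerm p) {u v : Sigma PTerm} (hu : u ∈ t.proper)
    (hv : v ∈ u.2.subs) : v ∈ t.proper := by
  cases t with
  | app f t => exact t.mem_subs_trans hu hv
  | _ => simp [PTerm.proper] at hu

theorem Atom.mem_subs_trans {σ : SSort} (a : Atom σ) {u v : Sigma PTerm} (hu : u ∈ a.subs)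
    (hv : v ∈ u.2.subs) : v ∈ a.subs := by
  cases a with
  | field f t => exact t.mem_subs_trans hu hv
  | _ => simp [Atom.subs] at hu

theorem Clause.mem_guardTerms_trans {c : Clause} {u v : Sigma PTerm} (hu : u ∈ c.guardTerms)
    (hv : v ∈ u.2.subs) : v ∈ c.guardTerms := by
  simp only [Clause.guardTerms, List.mem_append, List.mem_flatMap] at hu ⊢
  refine hu.imp (Or.imp ?_ ?_) ?_
  · exact fun ⟨e, he, h⟩ => ⟨e, he, h.imp (fun h => e.lhs.mem_proper_trans h hv)
      fun h => e.rhs.mem_proper_trans h hv⟩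
  · exact fun ⟨e, he, h⟩ => ⟨e, he, h.imp (fun h => e.lhs.mem_subs_trans h hv)
      fun h => e.rhs.mem_subs_trans h hv⟩
  · exact fun ⟨a, ha, h⟩ => ⟨a, ha, a.2.mem_subs_trans h hv⟩

/-- Guard terms are closed under subterms, so the added disjuncts `u = null` create no new terms to
be guarded. -/
theorem Clause.mem_guardTerms_of_guarded {pos neg : List PEq} {body : SForm Atom}
    {u : Sigma PTerm} (hu : u ∈ (Clause.guarded pos neg body).guardTerms) :
    u ∈ Clause.guardTerms ⟨pos, neg, body⟩ := by
  have h : u ∈ (((Clause.guardTerms ⟨pos, neg, body⟩).map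
      (fun u => (⟨u.1, u.2, .null u.1⟩ : PEq))).flatMap
        (fun e => e.lhs.proper ++ e.rhs.proper)) ∨ u ∈ Clause.guardTerms ⟨pos, neg, body⟩ := by
    simpa only [Clause.guardTerms, Clause.guarded, List.flatMap_append, List.mem_append,
      or_assoc] using hu
  rcases h with h | h
  · simp only [List.flatMap_map, List.mem_flatMap, List.mem_append] at h
    obtain ⟨x, hx, h | h⟩ := h
    · exact Clause.mem_guardTerms_trans hx (x.2.mem_subs_of_mem_proper h)
    · simp [PTerm.proper] at h
  · exact h

theorem Clause.guarded_isRule {pos neg : List PEq} {body : SForm Atom} (h : body.Closed) :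
    (Clause.guarded pos neg body).IsRule :=
  ⟨h, fun _ hu => Or.inr (Or.inl (List.mem_append_left _ (List.mem_map_of_mem
    (f := fun u : Sigma PTerm => (⟨u.1, u.2, .null u.1⟩ : PEq))
    (Clause.mem_guardTerms_of_guarded hu))))⟩

theorem ptrEq_isRule {p : PSort} (t u : PTerm p) : (ptrEq t u).IsRule :=
  Clause.guarded_isRule rfl

theorem scal_isRule {φ : SForm Atom} (h : φ.Closed) : (scal φ).IsRule :=
  Clause.guarded_isRule h

theorem scalNe_isRule {p : PSort} (t u : PTerm p) {φ : SForm Atom} (h : φ.Closed) :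
    (scalNe t u φ).IsRule :=
  Clause.guarded_isRule h

theorem vars_numeral (n : ℕ) : (numeral n).vars = ∅ := by
  induction n with
  | zero => rfl
  | succ n ih => simp [numeral, add, STerm.vars, ih]

theorem pcAt_isRule (b : Bool) (n : ℕ) : (pcAt b n).IsRule :=
  scal_isRule (by simp [SForm.Closed, eq, SForm.free, STerm.vars, vars_numeral])

theorem stateAxioms_isRule : ∀ c ∈ stateAxioms, c.IsRule := by
  simp only [stateAxioms, List.forall_mem_cons]
  refine ⟨scal_isRule ?_, scal_isRule ?_, scalNe_isRule _ _ ?_, ptrEq_isRule _ _, ptrEq_isRule _ _,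
    scal_isRule ?_, scal_isRule ?_, scalNe_isRule _ _ ?_, scal_isRule ?_, scal_isRule ?_,
    scal_isRule ?_, scal_isRule ?_, by simp⟩ <;>
  simp [SForm.Closed, SForm.free, STerm.vars, lt, le, ne, add, sub, mul, tid, sid, length, lmax,
    fld, gmax, decmax, dist, dt]

theorem background_isRule : ∀ c ∈ background, c.IsRule := by
  intro c hc
  rcases List.mem_append.1 hc with hc | hc
  · exact stateAxioms_isRule c hc
  · obtain ⟨c', hc', rfl⟩ := List.mem_map.1 hc
    exact (stateAxioms_isRule c' hc').prime

theorem initSchema_isRule : ∀ c ∈ initSchema, c.IsRule := by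
  simp only [initSchema, List.forall_mem_cons]
  refine ⟨ptrEq_isRule _ _, ptrEq_isRule _ _, ptrEq_isRule _ _, scal_isRule ?_, scal_isRule ?_,
    scal_isRule ?_, scal_isRule ?_, ptrEq_isRule _ _, by simp⟩ <;>
  simp [SForm.Closed, SForm.free, STerm.vars, lt, le, eq, SForm.or, sub, tid, length,
    lmax, fld, pos, spd, alloc]

theorem init_isRule (E : Effects) : ∀ c ∈ (system E).init, c.IsRule :=
  List.forall_mem_cons.2 ⟨pcAt_isRule _ _, initSchema_isRule⟩

theorem safe_isRule : ∀ c ∈ safe, c.IsRule := by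
  simp only [safe, List.forall_mem_cons]
  exact ⟨scalNe_isRule _ _ (by simp [SForm.Closed, SForm.free, STerm.vars, ne, sid, fld]), by simp⟩

theorem frame_isRule (f : Field) : (frame f).IsRule := by
  cases f
  all_goals first
    | exact ptrEq_isRule _ _
    | exact scal_isRule (by simp [SForm.Closed, SForm.free, STerm.vars, eq, fld, req, alloc, spd,
        pos])

theorem updSpd_wellFormed : updSpd.WellFormed := by
  simp only [Schema.WellFormed, updSpd, List.forall_mem_cons]
  refine ⟨scal_isRule ?_, scal_isRule ?_, scal_isRule ?_, by simp⟩ <;>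
  simp [SForm.Closed, SForm.free, STerm.vars, SForm.imp, lt, le, eq, ne, sub, mul, tid, length,
    lmax, fld, pos, spd, alloc, braked, decmax, dist, dt]

theorem Schema.WellFormed.clauses_isRule {E : Schema} (h : E.WellFormed) :
    ∀ c ∈ E.clauses, c.IsRule := by
  intro c hc
  rcases List.mem_append.1 hc with hc | hc
  · exact h c hc
  · obtain ⟨f, -, rfl⟩ := List.mem_map.1 hc
    exact frame_isRule f

theorem transition_isRule {E : Schema} (h : E.WellFormed) (m n : ℕ) :
    ∀ c ∈ transition m n E, c.IsRule :=
  List.forall_mem_cons.2 ⟨pcAt_isRule _ _, List.forall_mem_cons.2 ⟨pcAt_isRule _ _,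
    h.clauses_isRule⟩⟩

theorem update_isRule {E : Effects} (hE : E.WellFormed) :
    ∀ Φ ∈ (system E).update, ∀ c ∈ Φ, c.IsRule := by
  obtain ⟨h1, h2, h3, h4, h5⟩ := hE
  intro Φ hΦ
  simp only [system, List.mem_append, List.mem_map] at hΦ
  rcases hΦ with (hΦ | ⟨n, -, rfl⟩) | ⟨n, -, rfl⟩
  · simp only [List.mem_cons, List.not_mem_nil, or_false] at hΦ
    rcases hΦ with rfl | rfl | rfl | rfl
    · exact transition_isRule updSpd_wellFormed _ _
    · exact transition_isRule h1 _ _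
    · exact transition_isRule h2 _ _
    · exact transition_isRule h3 _ _
  · exact transition_isRule h4 _ _
  · exact transition_isRule h5 _ _

/-! ### Decision problems -/

theorem Decides.comap {α β : Type} {code : α → ℕ} {code' : β → ℕ} {D P : α → Prop}
    {D' P' : β → Prop} (h : Decides code D P) (g : β → α) {r : ℕ → ℕ} (hr : Primrec r)
    (hcode : ∀ x, code (g x) = r (code' x)) (hD : ∀ x, D' x → D (g x))
    (hP : ∀ x, P (g x) ↔ P' x) : Decides code' D' P' := by
  obtain ⟨f, hf, h⟩ := h
  refine ⟨fun n => f (r n), hf.comp hr.to_comp, fun x hx => ?_⟩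
  simp only [← hcode, h _ (hD x hx), hP]

theorem Decides.forall_mem {α ι : Type} {code : α → ℕ} {D : α → Prop} {P : ι → α → Prop}
    (L : List ι) (h : ∀ i ∈ L, Decides code D (P i)) :
    Decides code D fun x => ∀ i ∈ L, P i x := by
  induction L with
  | nil => exact ⟨fun _ => true, Computable.const _, by simp⟩
  | cons i L ih =>
    rw [List.forall_mem_cons] at h
    obtain ⟨f, hf, h1⟩ := h.1
    obtain ⟨g, hg, h2⟩ := ih h.2
    refine ⟨fun n => f n && g n, Primrec.and.to_comp.comp hf hg, fun x hx => ?_⟩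
    simp only [Bool.and_eq_true, h1 x hx, h2 x hx, List.forall_mem_cons]

theorem holdsAll_append {S : ScalarStr} (M : Str S) (Φ Ψ : List Clause) :
    HoldsAll M (Φ ++ Ψ) ↔ HoldsAll M Φ ∧ HoldsAll M Ψ := List.forall_mem_append

theorem codeClauses_append (Φ Ψ : List Clause) :
    codeClauses (Φ ++ Ψ) = Encodable.encode (Φ.map Clause.code ++ listOf (codeClauses Ψ)) := by
  simp [codeClauses]

theorem primrec_encode_append (L : List ℕ) :
    Primrec fun n => Encodable.encode (L ++ listOf n) :=
  Primrec.encode.comp (Primrec.list_append.comp (Primrec.const L) primrec_listOf)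

/-- Pointer equalities have the scalar part `falsum`, and the background theory contains one. This
puts the truth values, needed for decided equalities and empty conjunctions, into `F`. -/
theorem falsum_mem {F : Set ScalarFormula} {E : Effects}
    (hsys : ∀ φ ∈ systemScalarParts E, InFragment F φ) : SForm.falsum ∈ F := by
  have h : InFragment F (ptrEq (prevs (nexts vs)) vs).body := by
    refine hsys _ (List.mem_map_of_mem ?_)
    simp [background, stateAxioms]
  exact h fun _ _ => 0

end RBC

/-! ### The decision problems of the theorem -/

open RBC in
theorem mainTheorem3 (K : Set RBC.ScalarStr) (hK : ∀ S ∈ K, S.IsRealInt)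
    (E : RBC.Effects) (hE : E.WellFormed)
    (F : Set RBC.ScalarFormula) (hF : RBC.IsDecidableFragment K F)
    (hsys : ∀ φ ∈ RBC.systemScalarParts E, RBC.InFragment F φ) :
    RBC.Decides RBC.codeClauses (RBC.Admissible F)
        (fun Inv => RBC.Entails K RBC.background (RBC.asProp Inv) (RBC.asProp RBC.safe)) ∧
    RBC.Decides RBC.codeClauses (RBC.Admissible F)
        (fun Inv => RBC.Entails K RBC.background
          (RBC.asProp (RBC.system E).init) (RBC.asProp Inv)) ∧
    RBC.Decides RBC.codeClauses (RBC.Admissible F)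
        (fun Inv => RBC.Entails K RBC.background
          (RBC.asProp RBC.initSchema) (RBC.asProp Inv)) ∧
    RBC.Decides RBC.codeClauses (RBC.Admissible F)
        (fun Inv => RBC.Entails K RBC.background
          (fun S M => RBC.asProp Inv S M ∧ (RBC.system E).Update S M)
          (RBC.asProp (Inv.map RBC.Clause.prime))) := by
  have hfalse := falsum_mem hsys
  have mem : ∀ {Φ : List Clause}, (∀ c ∈ Φ, c ∈ background ++ (system E).init ++ safe ++
      (system E).update.flatten) → ∀ c ∈ Φ, InFragment F c.body :=
    fun h c hc => hsys _ (List.mem_map_of_mem (h c hc))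
  have mem_bg := mem (Φ := background) fun c hc => by simp [hc]
  have mem_init := mem (Φ := (system E).init) fun c hc => by simp [hc]
  have mem_safe := mem (Φ := safe) fun c hc => by simp [hc]
  have mem_update : ∀ Φ ∈ (system E).update, ∀ c ∈ Φ, InFragment F c.body := fun Φ hΦ =>
    mem fun c hc => List.mem_append_right _ (List.mem_flatten_of_mem hΦ hc)
  have good_bg : ∀ c ∈ background, c.IsRule ∧ InFragment F c.body :=
    fun c hc => ⟨background_isRule c hc, mem_bg c hc⟩
  have good_inv : ∀ {Inv : List Clause}, Admissible F Inv →
      ∀ c ∈ Inv, c.IsRule ∧ InFragment F c.body :=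
    fun h c hc => ⟨(h c hc).1.isRule, (h c hc).2.2⟩
  have goal_inv : ∀ {Inv : List Clause}, Admissible F Inv →
      ∀ c ∈ Inv, c.body.Closed ∧ InFragment F c.body :=
    fun h c hc => ⟨(h c hc).1.2.1, (h c hc).2.2⟩
  have from_init : ∀ Φ : List Clause, (∀ c ∈ Φ, c.IsRule ∧ InFragment F c.body) →
      Decides codeClauses (Admissible F)
        (fun Inv => Entails K background (asProp Φ) (asProp Inv)) := by
    intro Φ hΦ
    refine (hF.decides_entailment hfalse false).comap (fun Inv => (background ++ Φ, Inv))
      (primrec_pair (Primrec.const (codeClauses (background ++ Φ))) Primrec.id) (fun _ => rfl)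
      (fun Inv h => ⟨List.forall_mem_append.2 ⟨good_bg, hΦ⟩, goal_inv h⟩) fun Inv => ?_
    simp only [holdsAll_append, Str.primeIf_false, and_imp]
    rfl
  refine ⟨?_, from_init _ fun c hc => ⟨init_isRule E c hc, mem_init c hc⟩,
    from_init _ fun c hc => ⟨initSchema_isRule c hc, mem_init c (List.mem_cons_of_mem _ hc)⟩, ?_⟩
  · refine (hF.decides_entailment hfalse false).comap (fun Inv => (background ++ Inv, safe))
      (primrec_pair (primrec_encode_append (background.map Clause.code))
        (Primrec.const (codeClauses safe)))
      (fun Inv => by rw [codeClauses_append])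
      (fun Inv h => ⟨List.forall_mem_append.2 ⟨good_bg, good_inv h⟩,
        fun c hc => ⟨(safe_isRule c hc).1, mem_safe c hc⟩⟩) fun Inv => ?_
    simp only [holdsAll_append, Str.primeIf_false, and_imp]
    rfl
  -- An entailment from a disjunction of transitions is the conjunction of the entailments from each
  -- of them. The goal is the unprimed `Inv`, evaluated in the primed reduct.
  · refine (Decides.forall_mem (system E).update fun Φ hΦ =>
      (hF.decides_entailment hfalse true).comap (code' := codeClauses) (D' := Admissible F)
        (fun Inv => ((background ++ Φ) ++ Inv, Inv))
        (primrec_pair (primrec_encode_append ((background ++ Φ).map Clause.code)) Primrec.id)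
        (fun Inv => by rw [codeClauses_append]; rfl)
        (fun Inv h => ⟨List.forall_mem_append.2 ⟨List.forall_mem_append.2 ⟨good_bg,
          fun c hc => ⟨update_isRule hE Φ hΦ c hc, mem_update Φ hΦ c hc⟩⟩, good_inv h⟩,
          goal_inv h⟩) fun Inv => Iff.rfl).comap id Primrec.id (fun _ => rfl) (fun _ => id)
      fun Inv => ?_
    simp only [holdsAll_append, id, and_imp]
    constructor
    · rintro h S hS M hbg ⟨hinv, Φ, hΦ, hM⟩
      exact (holdsAll_prime M Inv).2 (h Φ hΦ S hS M hbg hM hinv)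
    · intro h Φ hΦ S hS M hbg hM hinv
      exact (holdsAll_prime M Inv).1 (h S hS M hbg ⟨hinv, Φ, hΦ, hM⟩)
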